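/- For each integer $n\ge 1$ let $\mu_n$ be a finite rotation-invariant Borel measure on $\mathbb{C}$, and write $M(n,k)=\int_{\mathbb{C}}|z|^k\,d\mu_n(z)$. Assume that for every integer $m$ (positive, negative or zero) $$\frac{M(n,2n+2m)}{M(n,2n)}\longrightarrow 1\qquad (n\to\infty);$$ in particular, for each fixed $m$ these moments are finite and non-zero for all large $n$. Let $$K_n(z,w)=\sum_{\ell=0}^{n-1}\frac{(z\bar w)^{\ell}}{M(n,2\ell)},$$ and let $z_1,\dots,z_n$ be random points (defined for each $n$ on some probability space, with expectation $\mathbf{E}_n$) forming the determinantal process $(K_n,\mu_n)$; that is, for every $k\ge 0$ and all pairwise disjoint Borel sets $B_1,\dots,B_k\subseteq\mathbb{C}$, $$\mathbf{E}_n\Bigl[\prod_{l=1}^k \#\{i: z_i\in B_l\}\Bigr]=\int_{B_1\times\cdots\times B_k}\det\bigl(K_n(x_i,x_j)\bigr)_{1\le i,j\le k}\,d\mu_n(x_1)\cdots d\mu_n(x_k).$$ Put $p_j=z_1^j+\cdots+z_n^j$. Then for every $k\ge 0$ and all fixed non-negative integers $a_1,\dots,a_k,b_1,\dots,b_k$,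 the expectations below are those of integrable random variables (the one on the left for all sufficiently large $n$), and $$\lim_{n\to\infty}\mathbf{E}_n\Bigl[\prod_{j=1}^k p_j^{a_j}\,\overline{p_j}^{\,b_j}\Bigr]=\mathbf{E}\Bigl[\prod_{j=1}^k\bigl(\sqrt{j}\,Z_j\bigr)^{a_j}\,\overline{\bigl(\sqrt{j}\,Z_j\bigr)^{b_j}}\Bigr],$$ where $Z_1,\dots,Z_k$ are independent standard complex Gaussian random variables (density $\pi^{-1}e^{-|z|^2}$ on $\mathbb{C}$). -/

import Mathlib

open MeasureTheory ProbabilityTheory Filter Topology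
open scoped ENNReal ComplexConjugate

noncomputable section

/-- A measure on the complex plane is rotation invariant if it is preserved by multiplication by
every complex number of modulus one. -/
def IsRotationInvariant (μ : Measure ℂ) : Prop :=
  ∀ u : ℂ, ‖u‖ = 1 → μ.map (fun z => u * z) = μ

/-- The absolute moment `M(k) = ∫ |z|^k dμ(z)`. -/
def absMoment (μ : Measure ℂ) (k : ℤ) : ℝ := ∫ z, ‖z‖ ^ k ∂μ

/-- The kernel `K_n(z, w) = ∑_{ℓ < n} M(2ℓ)⁻¹ (z w̄)^ℓ`. For rotation invariant `μ` it is the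
kernel, with respect to `μ`, of the projection of `L²(ℂ, μ)` onto the polynomials of degree less
than `n`. -/
def polyKernel (μ : Measure ℂ) (n : ℕ) (z w : ℂ) : ℂ :=
  ∑ l ∈ Finset.range n, (((absMoment μ (2 * (l : ℤ)))⁻¹ : ℝ) : ℂ) * (z * conj w) ^ l

/-- The number of the random points `z_1, …, z_N` (with multiplicity) which lie in `B`. -/
def pointCount {Ω : Type*} {N : ℕ} (z : Fin N → Ω → ℂ) (B : Set ℂ) (ω : Ω) : ℕ :=
  {i : Fin N | z i ω ∈ B}.ncard

/-- `ρ` is a `k`-point joint intensity, with respect to `μ`, of the process of the random points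
`z_1, …, z_N`: for all pairwise disjoint Borel sets `B_1, …, B_k`,
`E ∏ #{i : z_i ∈ B_l} = ∫_{B_1 × ⋯ × B_k} ρ dμ^k`. -/
def IsJointIntensity {Ω : Type*} [MeasurableSpace Ω] (P : Measure Ω) {N : ℕ}
    (z : Fin N → Ω → ℂ) (μ : Measure ℂ) (k : ℕ) (ρ : (Fin k → ℂ) → ℝ≥0∞) : Prop :=
  ∀ B : Fin k → Set ℂ, (∀ l, MeasurableSet (B l)) → Pairwise (Function.onFun Disjoint B) →
    ∫⁻ ω, ∏ l, (pointCount z (B l) ω : ℝ≥0∞) ∂P =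
      ∫⁻ x in Set.univ.pi B, ρ x ∂(Measure.pi fun _ : Fin k => μ)

/-- The random points `z_1, …, z_N` form the determinantal process `(K, μ)`: for every `k`, the
`k`-point joint intensity with respect to `μ` is `det (K(x_i, x_j))_{i, j ≤ k}`. (For a
positive semidefinite Hermitian kernel `K` this determinant is a nonnegative real number.) -/
def IsDeterminantalProcess {Ω : Type*} [MeasurableSpace Ω] (P : Measure Ω) {N : ℕ}
    (z : Fin N → Ω → ℂ) (K : ℂ → ℂ → ℂ) (μ : Measure ℂ) : Prop :=
  ∀ k : ℕ, IsJointIntensity P z μ k fun x =>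
    ENNReal.ofReal (Matrix.det (Matrix.of fun i j : Fin k => K (x i) (x j))).re

/-- The power sum `p_j = z_1^j + ⋯ + z_N^j`. -/
def powerSum {N : ℕ} (j : ℕ) (x : Fin N → ℂ) : ℂ := ∑ i, x i ^ j

/-- The standard complex Gaussian distribution, with density `π⁻¹ exp(-|z|²)` with respect to
Lebesgue measure on `ℂ`. -/
def stdComplexGaussian : Measure ℂ :=
  volume.withDensity fun z => ENNReal.ofReal (Real.pi⁻¹ * Real.exp (-‖z‖ ^ 2))

end

/-! Let `Δ` be the Vandermonde determinant and `p_a`, `p_b` products of power sums. The kernel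
matrix at `n` points factors through the Vandermonde matrix, so the symmetrized law of the points
has density `|Δ|² / ∏ M(n,2l)` (over `l < n`) with respect to the `n`-fold power of `μ_n`. Rotation
invariance makes monomials orthogonal. Hence `n!` times the mixed moment is the sum over exponents
`α` of the product of the coefficients of `p_a Δ` and `p_b Δ`, weighted by `∏ M(n,2α_i) / ∏
M(n,2l)`.

An exponent of `p_a Δ` has distinct entries, whose sum exceeds the minimal one by `d = deg p_a`. Its
entries therefore contain every integer below `n - d` and stay below `n + d`. After cancellation the
weight involves only moments with index near `2n`, and the hypothesis makes it tend to 1 uniformly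
in `α`.

With all weights equal to 1 (the case of Haar unitary matrices) the answer is exact once `n` is at
least both degrees. The adjoints of multiplication by power sums satisfy the canonical commutation
relations on the `p_a Δ` and annihilate `Δ`, as in a Fock space (`coeffPairing_psumProd`), which
gives the Gaussian moments. Cauchy–Schwarz bounds the effect of changing the weights by unweighted
norms, which after division by `n!` no longer depend on `n` (`abs_coeffPairing_relWeight_sub_le`).
-/

noncomputable section

/-! ### Coefficient pairing, lowering operators and their commutation relation. -/

namespace MvPolynomial

variable {ι : Type*}

/-- The bilinear form on real polynomials for which the monomials are orthogonal, the monomial with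
exponent `α` having squared norm `w α`. -/
def coeffPairing (w : (ι →₀ ℕ) → ℝ) (P Q : MvPolynomial ι ℝ) : ℝ :=
  ∑ α ∈ P.support, coeff α P * coeff α Q * w α

theorem coeffPairing_eq_sum (w : (ι →₀ ℕ) → ℝ) {P : MvPolynomial ι ℝ} (Q : MvPolynomial ι ℝ)
    {s : Finset (ι →₀ ℕ)} (hs : P.support ⊆ s) :
    coeffPairing w P Q = ∑ α ∈ s, coeff α P * coeff α Q * w α := by
  refine Finset.sum_subset hs fun α _ h => ?_
  rw [notMem_support_iff.1 h]; ring

theorem coeffPairing_comm (w : (ι →₀ ℕ) → ℝ) (P Q : MvPolynomial ι ℝ) :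
    coeffPairing w P Q = coeffPairing w Q P := by
  classical
  rw [coeffPairing_eq_sum w Q (Finset.subset_union_left (s₂ := Q.support)),
    coeffPairing_eq_sum w P (Finset.subset_union_right (s₁ := P.support))]
  exact Finset.sum_congr rfl fun α _ => by ring

theorem coeffPairing_add_left (w : (ι →₀ ℕ) → ℝ) (P P' Q : MvPolynomial ι ℝ) :
    coeffPairing w (P + P') Q = coeffPairing w P Q + coeffPairing w P' Q := by
  classical
  rw [coeffPairing_eq_sum w Q (support_add (p := P) (q := P')),
    coeffPairing_eq_sum w Q (Finset.subset_union_left (s₂ := P'.support)),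
    coeffPairing_eq_sum w Q (Finset.subset_union_right (s₁ := P.support)), ← Finset.sum_add_distrib]
  exact Finset.sum_congr rfl fun α _ => by rw [coeff_add]; ring

@[simp] theorem coeffPairing_zero_left (w : (ι →₀ ℕ) → ℝ) (Q : MvPolynomial ι ℝ) :
    coeffPairing w 0 Q = 0 := by
  simp [coeffPairing]

theorem coeffPairing_sum_left {κ : Type*} (w : (ι →₀ ℕ) → ℝ) (s : Finset κ)
    (P : κ → MvPolynomial ι ℝ) (Q : MvPolynomial ι ℝ) :
    coeffPairing w (∑ i ∈ s, P i) Q = ∑ i ∈ s, coeffPairing w (P i) Q := by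
  classical
  induction s using Finset.induction_on with
  | empty => simp
  | insert i s hi ih => rw [Finset.sum_insert hi, Finset.sum_insert hi, coeffPairing_add_left, ih]

theorem coeffPairing_monomial_left (w : (ι →₀ ℕ) → ℝ) (α : ι →₀ ℕ) (c : ℝ)
    (Q : MvPolynomial ι ℝ) :
    coeffPairing w (monomial α c) Q = c * coeff α Q * w α := by
  classical
  rw [coeffPairing_eq_sum w Q support_monomial_subset, Finset.sum_singleton, coeff_monomial,
    if_pos rfl]

theorem coeffPairing_smul_right (w : (ι →₀ ℕ) → ℝ) (c : ℝ) (P Q : MvPolynomial ι ℝ) :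
    coeffPairing w P (c • Q) = c * coeffPairing w P Q := by
  rw [coeffPairing, coeffPairing, Finset.mul_sum]
  exact Finset.sum_congr rfl fun α _ => by rw [coeff_smul, smul_eq_mul]; ring

/-- The Cauchy–Schwarz inequality for sums of products of coefficients. -/
theorem sum_abs_coeff_mul_le (P Q : MvPolynomial ι ℝ) :
    ∑ α ∈ P.support, |coeff α P * coeff α Q| ≤
      √(coeffPairing (fun _ => 1) P P) * √(coeffPairing (fun _ => 1) Q Q) := by
  classical
  have h := Real.sum_mul_le_sqrt_mul_sqrt (P.support ∪ Q.support)
    (fun α => |coeff α P|) (fun α => |coeff α Q|)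
  rw [coeffPairing_eq_sum _ P (Finset.subset_union_left (s₂ := Q.support)),
    coeffPairing_eq_sum _ Q (Finset.subset_union_right (s₁ := P.support))]
  simp only [sq_abs, ← abs_mul] at h
  simp only [mul_one, ← sq]
  exact (Finset.sum_le_sum_of_subset_of_nonneg Finset.subset_union_left
    fun _ _ _ => abs_nonneg _).trans h

theorem _root_.Finsupp.mapDomain_swap_eq [DecidableEq ι] {α : ι →₀ ℕ} {i j : ι} (hij : α i = α j) :
    α.mapDomain (Equiv.swap i j) = α := by
  ext l
  rw [← Finsupp.equivMapDomain_eq_mapDomain, Finsupp.equivMapDomain_apply, Equiv.symm_swap]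
  by_cases h1 : l = i
  · subst h1; simp [hij]
  by_cases h2 : l = j
  · subst h2; simp [hij]
  rw [Equiv.swap_apply_of_ne_of_ne h1 h2]

variable [Fintype ι]

/-- The adjoint of multiplication by the `k`-th power sum: the sum over the variables of the
truncated divisions by the `k`-th power of that variable. -/
def lowering (k : ℕ) (Q : MvPolynomial ι ℝ) : MvPolynomial ι ℝ :=
  ∑ i, Q.divMonomial (Finsupp.single i k)

theorem coeff_lowering (k : ℕ) (Q : MvPolynomial ι ℝ) (α : ι →₀ ℕ) :
    coeff α (lowering k Q) = ∑ i, coeff (α + Finsupp.single i k) Q := by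
  rw [lowering, coeff_sum]
  exact Finset.sum_congr rfl fun i _ => by rw [coeff_divMonomial, add_comm]

theorem psum_eq_sum_monomial (k : ℕ) :
    psum ι ℝ k = ∑ i, monomial (Finsupp.single i k) 1 := by
  simp [psum, X_pow_eq_monomial]

theorem coeff_psum_mul (k : ℕ) (Q : MvPolynomial ι ℝ) (α : ι →₀ ℕ) :
    coeff α (psum ι ℝ k * Q) =
      ∑ i, if k ≤ α i then coeff (α - Finsupp.single i k) Q else 0 := by
  rw [psum_eq_sum_monomial, Finset.sum_mul, coeff_sum]
  refine Finset.sum_congr rfl fun i _ => ?_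
  rw [coeff_monomial_mul']
  simp

theorem coeffPairing_psum_mul (k : ℕ) (P Q : MvPolynomial ι ℝ) :
    coeffPairing (fun _ => 1) (psum ι ℝ k * P) Q =
      coeffPairing (fun _ => 1) P (lowering k Q) := by
  induction P using MvPolynomial.induction_on' with
  | monomial α c =>
    rw [psum_eq_sum_monomial, Finset.sum_mul, coeffPairing_sum_left, coeffPairing_monomial_left,
      coeff_lowering, mul_one, Finset.mul_sum]
    refine Finset.sum_congr rfl fun i _ => ?_
    rw [monomial_mul, coeffPairing_monomial_left, add_comm]; ring
  | add P P' h h' => rw [mul_add, coeffPairing_add_left, h, h', coeffPairing_add_left]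

variable [DecidableEq ι]

/-- A polynomial is alternating if permuting the variables multiplies it by the sign of the
permutation. -/
def IsAlternating (Q : MvPolynomial ι ℝ) : Prop :=
  ∀ σ : Equiv.Perm ι, rename σ Q = (Equiv.Perm.sign σ : ℤ) • Q

namespace IsAlternating

variable {Q : MvPolynomial ι ℝ}

theorem psum_mul (h : IsAlternating Q) (k : ℕ) : IsAlternating (psum ι ℝ k * Q) := fun σ => by
  rw [map_mul, rename_psum, h σ, mul_smul_comm]

theorem coeff_mapDomain (h : IsAlternating Q) (σ : Equiv.Perm ι) (α : ι →₀ ℕ) :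
    coeff (α.mapDomain σ) Q = (Equiv.Perm.sign σ : ℤ) * coeff α Q := by
  have h1 := coeff_rename_mapDomain σ σ.injective Q α
  rw [h σ, coeff_smul, zsmul_eq_mul] at h1
  rw [← h1, ← mul_assoc, ← Int.cast_mul]
  simp

theorem coeff_mapDomain_swap (h : IsAlternating Q) {i j : ι} (hij : i ≠ j) (α : ι →₀ ℕ) :
    coeff (α.mapDomain (Equiv.swap i j)) Q = -coeff α Q := by
  rw [h.coeff_mapDomain, Equiv.Perm.sign_swap hij]
  simp

theorem injective_of_coeff_ne_zero (h : IsAlternating Q) {α : ι →₀ ℕ} (hα : coeff α Q ≠ 0) :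
    Function.Injective α := by
  intro i j hij
  by_contra hne
  have := h.coeff_mapDomain_swap hne α
  rw [Finsupp.mapDomain_swap_eq hij] at this
  exact hα (by linarith)

/-- Changing one exponent, and summing over the variables, gives zero as soon as each nonzero
summand takes an exponent to a different one, the old value remaining among the exponents. -/
theorem sum_coeff_update_eq_zero (h : IsAlternating Q) (c : ℕ → Prop) [DecidablePred c]
    (f : ℕ → ℕ) (α : ι →₀ ℕ)
    (hc : ∀ i, c (α i) → coeff (α.update i (f (α i))) Q ≠ 0 →
      f (α i) ≠ α i ∧ ∃ i', α.update i (f (α i)) i' = α i) :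
    ∑ i, (if c (α i) then coeff (α.update i (f (α i))) Q else 0) = 0 := by
  -- For distinct exponents, the old value that survives the update would have to occur twice in
  -- `α`, so every summand vanishes. Otherwise, swapping two variables with equal exponents permutes
  -- the summands and changes their signs.
  by_cases hα : Function.Injective α
  · refine Finset.sum_eq_zero fun i _ => ?_
    split_ifs with hi
    · by_contra hne
      obtain ⟨h1, i', h2⟩ := hc i hi hne
      by_cases hii : i' = i
      · subst hii; simp at h2; exact h1 h2
      · rw [Finsupp.update_apply, if_neg hii] at h2
        exact hii (hα h2)
    · rfl
  · obtain ⟨p, q, hpq, hne⟩ : ∃ p q, α p = α q ∧ p ≠ q := by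
      simpa [Function.Injective] using hα
    set τ := Equiv.swap p q with hτ
    have hατ : ∀ i, α (τ i) = α i := fun i => by
      have := DFunLike.congr_fun (Finsupp.mapDomain_swap_eq hpq) (τ i)
      rw [← hτ, Finsupp.mapDomain_apply τ.injective] at this
      exact this.symm
    have hup : ∀ i v, (α.update i v).mapDomain τ = α.update (τ i) v := fun i v => by
      ext l
      obtain ⟨l, rfl⟩ := τ.surjective l
      rw [Finsupp.mapDomain_apply τ.injective, Finsupp.update_apply, Finsupp.update_apply, hατ]
      simp
    have hsum := Equiv.sum_comp τ (fun i => if c (α i) then coeff (α.update i (f (α i))) Q else 0)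
    have hneg : ∑ i, (if c (α (τ i)) then coeff (α.update (τ i) (f (α (τ i)))) Q else 0) =
        - ∑ i, (if c (α i) then coeff (α.update i (f (α i))) Q else 0) := by
      rw [← Finset.sum_neg_distrib]
      refine Finset.sum_congr rfl fun i _ => ?_
      rw [hατ, ← hup, hτ, h.coeff_mapDomain_swap hne]
      split_ifs <;> simp
    linarith [hsum.symm.trans hneg]

/-- The canonical commutation relation. -/
theorem lowering_psum_mul (h : IsAlternating Q) {j : ℕ} (k : ℕ)
    (hfull : ∀ β, coeff β Q ≠ 0 → ∀ m < j, ∃ i, β i = m) :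
    lowering k (psum ι ℝ j * Q) =
      psum ι ℝ j * lowering k Q + (if j = k then (k : ℝ) else 0) • Q := by
  ext α
  -- Raising and lowering different variables commute. For the same variable the two orders differ
  -- only where truncation blocks one of them: `α i < j ≤ α i + k`.
  have hdiff : coeff α (lowering k (psum ι ℝ j * Q)) - coeff α (psum ι ℝ j * lowering k Q) =
      ∑ i, (if α i < j ∧ j ≤ α i + k then coeff (α.update i (α i + k - j)) Q else 0) := by
    simp_rw [coeff_lowering, coeff_psum_mul, coeff_lowering]
    have : ∀ i', (if j ≤ α i' then ∑ i, coeff (α - Finsupp.single i' j + Finsupp.single i k) Q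
        else 0) = ∑ i, if j ≤ α i' then
          coeff (α - Finsupp.single i' j + Finsupp.single i k) Q else 0 := fun i' => by
      split_ifs <;> simp
    simp_rw [this]
    rw [Finset.sum_comm (γ := ι) (f := fun i' i => if j ≤ α i' then
          coeff (α - Finsupp.single i' j + Finsupp.single i k) Q else 0),
      ← Finset.sum_sub_distrib]
    refine Finset.sum_congr rfl fun i _ => ?_
    rw [← Finset.sum_sub_distrib, Finset.sum_eq_single i]
    · by_cases h1 : j ≤ α i
      · rw [if_pos h1, if_pos (by simp; omega), if_neg (by omega), sub_eq_zero]
        congr 1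
        ext l
        by_cases hl : l = i
        · subst hl; simp; omega
        · simp [Ne.symm hl]
      · by_cases h2 : j ≤ α i + k
        · rw [if_neg h1, if_pos (by simpa using h2), if_pos ⟨by omega, h2⟩, sub_zero]
          congr 1
          ext l
          by_cases hl : l = i
          · subst hl; simp
          · simp [Finsupp.update_apply, hl]
        · rw [if_neg h1, if_neg (by simpa using h2), if_neg (by tauto), sub_zero]
    · intro l _ hl
      simp only [Finsupp.add_apply, Finsupp.single_apply, if_neg hl.symm, add_zero]
      split_ifs with h1
      · rw [sub_eq_zero]
        congr 1
        ext m
        by_cases hm : m = l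
        · subst hm; simp [hl.symm]
        · simp [Finsupp.single_apply, Ne.symm hm]
      · simp
    · simp
  rw [coeff_add, ← sub_eq_iff_eq_add', hdiff, coeff_smul, smul_eq_mul]
  by_cases hjk : j = k
  · subst hjk
    have hu : ∀ i, α.update i (α i + j - j) = α := fun i => by simp
    simp_rw [hu]
    rw [← Finset.sum_filter, Finset.sum_const, nsmul_eq_mul, if_pos trivial]
    by_cases hα : coeff α Q = 0
    · simp [hα]
    congr 2
    -- The exponents are distinct and include all of `0, …, j - 1`, so exactly `j` of them lie below
    -- `j`.
    rw [← Finset.card_range j, ← Finset.card_image_of_injective _ (h.injective_of_coeff_ne_zero hα)]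
    congr 1
    ext m
    simp only [Finset.mem_image, Finset.mem_filter, Finset.mem_univ, true_and, Finset.mem_range,
      Finset.card_range]
    constructor
    · rintro ⟨i, hi, rfl⟩; exact hi.1
    · intro hm
      obtain ⟨i, rfl⟩ := hfull α hα m hm
      exact ⟨i, ⟨hm, by omega⟩, rfl⟩
  · rw [if_neg hjk, zero_mul]
    refine h.sum_coeff_update_eq_zero (fun m => m < j ∧ j ≤ m + k) (fun m => m + k - j) α
      fun i hi hne => ⟨by omega, hfull _ hne _ hi.1⟩

/-- When the exponents form an initial segment, one raised from `m` to `m + k` must leave another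
equal to `m`; the alternating symmetry then cancels the sum. -/
theorem lowering_eq_zero (h : IsAlternating Q) {k : ℕ} (hk : k ≠ 0)
    (hfull : ∀ β, coeff β Q ≠ 0 → ∀ i, ∀ m < β i, ∃ i', β i' = m) :
    lowering k Q = 0 := by
  ext α
  rw [coeff_lowering, coeff_zero]
  have hu : ∀ i, α + Finsupp.single i k = α.update i (α i + k) := fun i => by
    ext l
    by_cases hl : l = i
    · subst hl; simp
    · simp [Finsupp.update_apply, hl]
  have := h.sum_coeff_update_eq_zero (fun _ => True) (fun m => m + k) α
    fun i _ hne => ⟨by omega, hfull _ hne i _ (by simp; omega)⟩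
  simpa [hu] using this

end IsAlternating

end MvPolynomial
end

/-! ### Power sums times the Vandermonde determinant: exponents and orthogonality. -/

noncomputable section

theorem Finset.sum_range_card_le_sum (S : Finset ℕ) : ∑ l ∈ range S.card, l ≤ ∑ l ∈ S, l := by
  induction S using Finset.induction_on_max with
  | empty => simp
  | insert a S ha ih =>
    have hn : a ∉ S := fun h => lt_irrefl _ (ha a h)
    rw [card_insert_of_notMem hn, sum_range_succ, sum_insert hn, add_comm]
    have : S.card ≤ a := by
      simpa using card_le_card (show S ⊆ range a from fun x hx => mem_range.2 (ha x hx))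
    omega

/-- Adjoining a missing `m` gives `S.card + 1` distinct integers, whose sum is at least that of the
initial segment; this forces `S.card ≤ m + d`. -/
theorem Finset.mem_of_sum_eq_sum_range_add {S : Finset ℕ} {d m : ℕ}
    (hS : ∑ l ∈ S, l = ∑ l ∈ range S.card, l + d) (hm : m + d < S.card) : m ∈ S := by
  by_contra hn
  have h := sum_range_card_le_sum (insert m S)
  rw [card_insert_of_notMem hn, sum_range_succ, sum_insert hn] at h
  omega

/-- Removing `m` leaves a sum no smaller than the minimal one, so `m` exceeds `S.card - 1` by at
most `d`. -/
theorem Finset.lt_of_sum_eq_sum_range_add {S : Finset ℕ} {d m : ℕ}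
    (hS : ∑ l ∈ S, l = ∑ l ∈ range S.card, l + d) (hm : m ∈ S) : m < S.card + d := by
  have h := sum_range_card_le_sum (S.erase m)
  have h1 := add_sum_erase S (fun l => l) hm
  have h2 := card_erase_add_one hm
  rw [← h2, sum_range_succ] at hS
  omega

theorem Finsupp.induction_add_single_one {κ : Type*} {p : (κ →₀ ℕ) → Prop} (zero : p 0)
    (add_single : ∀ a j, p a → p (a + single j 1)) (a : κ →₀ ℕ) : p a := by
  have key : ∀ g, p g → p (g + a) := by
    induction a using Finsupp.induction_linear with
    | zero => simp
    | add f f' h h' => intro g hg; rw [← add_assoc]; exact h' _ (h _ hg)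
    | single j m =>
      induction m with
      | zero => simp
      | succ m ih =>
        intro g hg
        rw [single_add, ← add_assoc]
        exact add_single _ _ (ih _ hg)
  simpa using key 0 zero

namespace MvPolynomial

/-- The Vandermonde determinant, as a polynomial. -/
def vandermondeDet (n : ℕ) : MvPolynomial (Fin n) ℝ := (Matrix.vandermonde X).det

theorem vandermondeDet_isAlternating (n : ℕ) : IsAlternating (vandermondeDet n) := fun σ => by
  rw [vandermondeDet, AlgHom.map_det, zsmul_eq_mul, ← Matrix.det_permute]
  congr 1
  ext i j : 2
  simp [Matrix.vandermonde_apply]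

theorem vandermondeDet_eq_sum (n : ℕ) : vandermondeDet n =
    ∑ σ : Equiv.Perm (Fin n),
      monomial (Finsupp.equivFunOnFinite.symm fun i => (σ⁻¹ i : ℕ)) ((Equiv.Perm.sign σ : ℤ) : ℝ) := by
  rw [vandermondeDet, Matrix.det_apply']
  refine Finset.sum_congr rfl fun σ _ => ?_
  rw [monomial_eq, Finsupp.prod_fintype _ _ (by simp),
    ← Equiv.prod_comp σ (fun i => X i ^ _)]
  simp [Matrix.vandermonde_apply]

theorem vandermondeDet_isHomogeneous (n : ℕ) :
    (vandermondeDet n).IsHomogeneous (∑ l ∈ Finset.range n, l) := by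
  rw [vandermondeDet_eq_sum]
  refine IsHomogeneous.sum _ _ _ fun σ _ => isHomogeneous_monomial _ ?_
  rw [Finsupp.degree_eq_sum]
  simp only [Finsupp.coe_equivFunOnFinite_symm]
  rw [Equiv.sum_comp σ⁻¹ (fun i : Fin n => (i : ℕ)), Fin.sum_univ_eq_sum_range (fun i => i)]

theorem coeffPairing_vandermondeDet (n : ℕ) :
    coeffPairing (fun _ => 1) (vandermondeDet n) (vandermondeDet n) = (n.factorial : ℝ) := by
  conv_lhs => rw [vandermondeDet_eq_sum]
  rw [coeffPairing_sum_left, Finset.sum_congr rfl (g := fun _ => (1 : ℝ))]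
  · simp [Fintype.card_perm]
  intro σ _
  rw [coeffPairing_monomial_left, coeff_sum, Finset.sum_eq_single σ]
  · rw [coeff_monomial, if_pos rfl, ← Int.cast_mul]; simp
  · intro τ _ hτ
    rw [coeff_monomial, if_neg]
    intro h
    refine hτ (inv_injective (Equiv.ext fun i => Fin.ext ?_))
    exact congr_fun (Finsupp.equivFunOnFinite.symm.injective h) i
  · simp

/-- A product of powers of power sums, the exponent of `p_{j+1}` being `a j`. -/
def psumProd (n : ℕ) {k : ℕ} (a : Fin k →₀ ℕ) : MvPolynomial (Fin n) ℝ :=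
  ∏ j : Fin k, psum (Fin n) ℝ ((j : ℕ) + 1) ^ a j

/-- The degree of `psumProd n a`. -/
def psumDegree {k : ℕ} (a : Fin k →₀ ℕ) : ℕ := ∑ j : Fin k, ((j : ℕ) + 1) * a j

variable {k : ℕ} {n : ℕ}

theorem psumProd_zero : psumProd n (0 : Fin k →₀ ℕ) = 1 := by simp [psumProd]

theorem psumDegree_add_single (a : Fin k →₀ ℕ) (j : Fin k) :
    psumDegree (a + Finsupp.single j 1) = psumDegree a + (j + 1) := by
  simp only [psumDegree, Finsupp.add_apply, mul_add, Finset.sum_add_distrib]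
  simp [Finsupp.single_apply]

theorem psumProd_add_single (a : Fin k →₀ ℕ) (j : Fin k) :
    psumProd n (a + Finsupp.single j 1) = psum (Fin n) ℝ ((j : ℕ) + 1) * psumProd n a := by
  simp only [psumProd, Finsupp.add_apply, pow_add, Finset.prod_mul_distrib]
  rw [mul_comm]
  congr 1
  rw [Finset.prod_eq_single j] <;> simp +contextual [eq_comm]

theorem psum_isHomogeneous (ι : Type*) [Fintype ι] (m : ℕ) : (psum ι ℝ m).IsHomogeneous m :=
  IsHomogeneous.sum _ _ _ fun i _ => by simpa using (isHomogeneous_X ℝ i).pow m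

theorem psumProd_mul_isHomogeneous (a : Fin k →₀ ℕ) : (psumProd n a * vandermondeDet n).IsHomogeneous
    (∑ l ∈ Finset.range n, l + psumDegree a) := by
  rw [add_comm]
  refine IsHomogeneous.mul (IsHomogeneous.prod _ _ _ fun j _ => ?_) (vandermondeDet_isHomogeneous n)
  exact (psum_isHomogeneous _ _).pow _

theorem psumProd_mul_isAlternating (a : Fin k →₀ ℕ) :
    IsAlternating (psumProd n a * vandermondeDet n) := by
  induction a using Finsupp.induction_add_single_one with
  | zero => rw [psumProd_zero, one_mul]; exact vandermondeDet_isAlternating n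
  | add_single a j h => rw [psumProd_add_single, mul_assoc]; exact h.psum_mul _

theorem injective_of_coeff_psumProd_mul_ne_zero {a : Fin k →₀ ℕ} {α : Fin n →₀ ℕ}
    (hα : coeff α (psumProd n a * vandermondeDet n) ≠ 0) : Function.Injective α :=
  (psumProd_mul_isAlternating a).injective_of_coeff_ne_zero hα

theorem sum_image_of_coeff_psumProd_mul_ne_zero {a : Fin k →₀ ℕ} {α : Fin n →₀ ℕ}
    (hα : coeff α (psumProd n a * vandermondeDet n) ≠ 0) :
    (Finset.univ.image α).card = n ∧
    ∑ l ∈ Finset.univ.image α, l =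
      ∑ l ∈ Finset.range (Finset.univ.image α).card, l + psumDegree a := by
  have hinj := injective_of_coeff_psumProd_mul_ne_zero hα
  have hc : (Finset.univ.image α).card = n := by
    rw [Finset.card_image_of_injective _ hinj]; simp
  refine ⟨hc, ?_⟩
  rw [hc, Finset.sum_image fun _ _ _ _ h => hinj h]
  have := psumProd_mul_isHomogeneous a hα
  rw [Finsupp.weight_apply, Finsupp.sum_fintype _ _ (by simp)] at this
  simpa using this

theorem exists_eq_of_coeff_psumProd_mul_ne_zero {a : Fin k →₀ ℕ} {α : Fin n →₀ ℕ}
    (hα : coeff α (psumProd n a * vandermondeDet n) ≠ 0) {m : ℕ} (hm : m + psumDegree a < n) :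
    ∃ i, α i = m := by
  obtain ⟨hc, hs⟩ := sum_image_of_coeff_psumProd_mul_ne_zero hα
  simpa using Finset.mem_of_sum_eq_sum_range_add hs (hc.symm ▸ hm)

theorem lt_of_coeff_psumProd_mul_ne_zero {a : Fin k →₀ ℕ} {α : Fin n →₀ ℕ}
    (hα : coeff α (psumProd n a * vandermondeDet n) ≠ 0) (i : Fin n) : α i < n + psumDegree a := by
  obtain ⟨hc, hs⟩ := sum_image_of_coeff_psumProd_mul_ne_zero hα
  simpa [hc] using Finset.lt_of_sum_eq_sum_range_add hs
    (Finset.mem_image_of_mem _ (Finset.mem_univ i))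

theorem lowering_vandermondeDet {m : ℕ} (hm : m ≠ 0) : lowering m (vandermondeDet n) = 0 := by
  -- The empty product has degree 0, so the exponent bounds apply to the determinant itself.
  have h0 : vandermondeDet n = psumProd n (0 : Fin 0 →₀ ℕ) * vandermondeDet n := by
    rw [psumProd_zero, one_mul]
  refine (vandermondeDet_isAlternating n).lowering_eq_zero hm fun β hβ i m hm => ?_
  rw [h0] at hβ
  have := lt_of_coeff_psumProd_mul_ne_zero hβ i
  exact exists_eq_of_coeff_psumProd_mul_ne_zero hβ (by simp [psumDegree] at this ⊢; omega)

/-- Lowering acts as `(m + 1) ∂/∂p_{m+1}`: it is commuted past one power sum at a time until it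
annihilates the Vandermonde determinant. The degree bound guarantees the small exponents needed by
each commutation. -/
theorem lowering_psumProd_mul (m : Fin k) (a : Fin k →₀ ℕ) (ha : psumDegree a ≤ n) :
    lowering ((m : ℕ) + 1) (psumProd n a * vandermondeDet n) =
      (((m : ℕ) + 1 : ℝ) * a m) • (psumProd n (a - Finsupp.single m 1) * vandermondeDet n) := by
  induction a using Finsupp.induction_add_single_one with
  | zero => rw [psumProd_zero, one_mul, lowering_vandermondeDet (Nat.succ_ne_zero _)]; simp
  | add_single a j ih =>
    rw [psumDegree_add_single] at ha
    rw [psumProd_add_single, mul_assoc, (psumProd_mul_isAlternating a).lowering_psum_mul,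
      ih (by omega)]
    · by_cases hjm : j = m
      · subst hjm
        rw [if_pos rfl, add_tsub_cancel_right, mul_smul_comm, ← mul_assoc]
        -- If `a j = 0`, the truncated exponent `a - single j 1` is harmless, as its coefficient is
        -- zero.
        by_cases h0 : a j = 0
        · simp [h0]
        · have : a - Finsupp.single j 1 + Finsupp.single j 1 = a :=
            tsub_add_cancel_of_le (by simpa [Nat.one_le_iff_ne_zero] using h0)
          rw [← psumProd_add_single, this, ← add_smul]
          congr 1
          simp; ring
      · have h1 : a + Finsupp.single j 1 - Finsupp.single m 1 =
            a - Finsupp.single m 1 + Finsupp.single j 1 := by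
          ext l
          simp only [Finsupp.tsub_apply, Finsupp.add_apply, Finsupp.single_apply]
          by_cases h : j = l
          · have : m ≠ l := fun hm => hjm (h.trans hm.symm)
            simp [h, this]
          · simp [h]
        have h2 : ¬ ((j : ℕ) + 1 = m + 1) := fun h => hjm (Fin.ext (by omega))
        rw [if_neg h2, h1, psumProd_add_single, mul_smul_comm, zero_smul, add_zero, mul_assoc]
        simp [Ne.symm hjm]
    · intro β hβ l hl
      exact exists_eq_of_coeff_psumProd_mul_ne_zero hβ (by omega)

/-- Products of power sums, multiplied by the Vandermonde determinant, are orthogonal. -/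
theorem coeffPairing_psumProd (a b : Fin k →₀ ℕ) (ha : psumDegree a ≤ n) (hb : psumDegree b ≤ n) :
    coeffPairing (fun _ => 1) (psumProd n a * vandermondeDet n) (psumProd n b * vandermondeDet n) =
      n.factorial * if a = b then ∏ j : Fin k, ((j : ℕ) + 1 : ℝ) ^ a j * (a j).factorial else 0 := by
  induction a using Finsupp.induction_add_single_one generalizing b with
  | zero =>
    induction b using Finsupp.induction_add_single_one with
    | zero => simp [psumProd_zero, coeffPairing_vandermondeDet]
    | add_single b j _ =>
      rw [coeffPairing_comm, psumProd_add_single, mul_assoc, coeffPairing_psum_mul, psumProd_zero,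
        one_mul, lowering_vandermondeDet (Nat.succ_ne_zero _), coeffPairing_comm, if_neg]
      · simp
      · intro h
        simpa using DFunLike.congr_fun h j
  | add_single a j ih =>
    rw [psumDegree_add_single] at ha
    rw [psumProd_add_single, mul_assoc, coeffPairing_psum_mul, lowering_psumProd_mul _ _ hb,
      coeffPairing_smul_right]
    by_cases h0 : b j = 0
    · rw [if_neg]
      · simp [h0]
      · intro h
        have := DFunLike.congr_fun h j
        simp [h0] at this
    · obtain ⟨b, rfl⟩ : ∃ b', b = b' + Finsupp.single j 1 :=
        ⟨b - Finsupp.single j 1,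
          (tsub_add_cancel_of_le (by simpa [Nat.one_le_iff_ne_zero] using h0)).symm⟩
      rw [psumDegree_add_single] at hb
      rw [add_tsub_cancel_right, ih b (by omega) (by omega)]
      simp only [add_left_inj]
      split_ifs with hab
      · subst hab
        have : ∀ c : Fin k →₀ ℕ, ∏ l : Fin k, ((l : ℕ) + 1 : ℝ) ^ c l * (c l).factorial =
            ((j : ℕ) + 1 : ℝ) ^ c j * (c j).factorial * ∏ l ∈ Finset.univ.erase j,
              ((l : ℕ) + 1 : ℝ) ^ c l * (c l).factorial := fun c =>
          (Finset.mul_prod_erase _ _ (Finset.mem_univ j)).symm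
        have hrest : ∏ l ∈ Finset.univ.erase j, ((l : ℕ) + 1 : ℝ) ^ (a + Finsupp.single j 1 : Fin k →₀ ℕ) l *
            ((a + Finsupp.single j 1 : Fin k →₀ ℕ) l).factorial =
            ∏ l ∈ Finset.univ.erase j, ((l : ℕ) + 1 : ℝ) ^ a l * (a l).factorial :=
          Finset.prod_congr rfl fun l hl => by
            simp [Ne.symm (Finset.ne_of_mem_erase hl)]
        rw [this, this (a + _), hrest]
        simp [Nat.factorial_succ, pow_succ]
        ring
      · simp

end MvPolynomial
end

/-! ### Moments of a rotation-invariant measure and orthogonality of monomials. -/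

noncomputable section

theorem IsRotationInvariant.integral_pow_mul_conj_pow {μ : Measure ℂ} (h : IsRotationInvariant μ)
    (a b : ℕ) : ∫ z, z ^ a * conj z ^ b ∂μ = if a = b then (absMoment μ (2 * (a : ℤ)) : ℂ) else 0 := by
  split_ifs with hab
  · subst hab
    rw [absMoment, ← integral_complex_ofReal]
    congr 1
    ext z
    rw [← mul_pow, Complex.mul_conj, Complex.normSq_eq_norm_sq, zpow_mul]
    norm_cast
  -- This rotation satisfies `u ^ (a - b) = -1`, so the integral equals its own negative, whether or
  -- not the integrand is integrable.
  · set u : ℂ := Complex.exp ((Real.pi / ((a : ℝ) - b) : ℝ) * Complex.I) with hu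
    have hab' : (a : ℂ) - b ≠ 0 := sub_ne_zero.2 (by exact_mod_cast hab)
    have hu1 : u ^ a * conj u ^ b = -1 := by
      rw [hu, ← Complex.exp_conj, ← Complex.exp_nat_mul, ← Complex.exp_nat_mul, ← Complex.exp_add,
        ← Complex.exp_pi_mul_I]
      congr 1
      simp only [map_mul, Complex.conj_ofReal, Complex.conj_I]
      push_cast
      field_simp
      ring
    have hcont : Continuous fun z : ℂ => z ^ a * conj z ^ b := by fun_prop
    have key : ∫ z, z ^ a * conj z ^ b ∂μ = -∫ z, z ^ a * conj z ^ b ∂μ := by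
      conv_lhs => rw [← h u (by rw [hu, Complex.norm_exp_ofReal_mul_I])]
      rw [integral_map (by fun_prop) hcont.aestronglyMeasurable, ← integral_neg]
      congr 1
      ext z
      rw [map_mul, mul_pow, mul_pow, mul_mul_mul_comm, hu1, neg_one_mul]
    exact self_eq_neg.1 key

/-- The integral of a non-integrable function is 0 by convention, so a nonzero moment is necessarily
a finite one. -/
theorem integrable_norm_pow_of_absMoment_ne_zero {μ : Measure ℂ} {L : ℕ}
    (hL : absMoment μ (2 * (L : ℤ)) ≠ 0) : Integrable (fun z : ℂ => ‖z‖ ^ (2 * L)) μ := by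
  by_contra h
  refine hL (integral_undef ?_)
  have : (fun z : ℂ => ‖z‖ ^ (2 * (L : ℤ))) = fun z : ℂ => ‖z‖ ^ (2 * L) := by
    ext z; exact_mod_cast zpow_natCast ‖z‖ (2 * L)
  rwa [this]

theorem integrable_pow_mul_conj_pow {μ : Measure ℂ} [IsFiniteMeasure μ] {L a b : ℕ}
    (hL : absMoment μ (2 * (L : ℤ)) ≠ 0) (hab : a + b ≤ 2 * L) :
    Integrable (fun z : ℂ => z ^ a * conj z ^ b) μ := by
  have hcont : Continuous fun z : ℂ => z ^ a * conj z ^ b := by fun_prop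
  refine ((integrable_const (1 : ℝ)).add (integrable_norm_pow_of_absMoment_ne_zero hL)).mono'
    hcont.aestronglyMeasurable (Eventually.of_forall fun z => ?_)
  simp only [norm_mul, norm_pow, RCLike.norm_conj, ← pow_add, Pi.add_apply]
  rcases le_total ‖z‖ 1 with h | h
  · exact (pow_le_one₀ (norm_nonneg z) h).trans (le_add_of_nonneg_right (by positivity))
  · exact (pow_le_pow_right₀ h hab).trans (le_add_of_nonneg_left zero_le_one)

/-- A vanishing lower moment would make `‖z‖ ^ (2 * l)`, and with it `‖z‖ ^ (2 * L)`, zero almost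
everywhere. -/
theorem absMoment_pos {μ : Measure ℂ} [IsFiniteMeasure μ] {L : ℕ}
    (hL : absMoment μ (2 * (L : ℤ)) ≠ 0) {l : ℕ} (hl : l ≤ L) :
    0 < absMoment μ (2 * (l : ℤ)) := by
  have hpow : ∀ m : ℕ, absMoment μ (2 * (m : ℤ)) = ∫ z, ‖z‖ ^ (2 * m) ∂μ := fun m => by
    rw [absMoment]
    congr 1
  have hint : Integrable (fun z : ℂ => ‖z‖ ^ (2 * l)) μ := by
    refine ((integrable_pow_mul_conj_pow hL (a := l) (b := l) (by omega)).norm).congr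
      (Eventually.of_forall fun z => ?_)
    simp [two_mul, pow_add]
  rw [hpow]
  refine lt_of_le_of_ne (integral_nonneg fun z => by positivity) fun h => hL ?_
  rw [eq_comm, integral_eq_zero_iff_of_nonneg (fun z => by positivity) hint] at h
  rw [hpow]
  refine integral_eq_zero_of_ae ?_
  filter_upwards [h] with z hz
  simp only [Pi.zero_apply, pow_eq_zero_iff'] at hz ⊢
  exact ⟨hz.1, by omega⟩

open MvPolynomial

theorem MvPolynomial.aeval_eq_sum_coeff {ι : Type*} [Fintype ι] (P : MvPolynomial ι ℝ) (x : ι → ℂ) :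
    aeval x P = ∑ α ∈ P.support, ((coeff α P : ℝ) : ℂ) * ∏ i, x i ^ α i := by
  rw [aeval_def, eval₂_eq']
  rfl

section Pairing

variable {ι : Type*} [Fintype ι] {μ : Measure ℂ} [IsFiniteMeasure μ] {L : ℕ}

theorem aeval_mul_conj_aeval_eq_sum (P Q : MvPolynomial ι ℝ) (x : ι → ℂ) :
    aeval x P * conj (aeval x Q) = ∑ α ∈ P.support, ∑ β ∈ Q.support,
      ((coeff α P * coeff β Q : ℝ) : ℂ) * ∏ i, (x i ^ α i * conj (x i) ^ β i) := by
  rw [aeval_eq_sum_coeff, aeval_eq_sum_coeff, map_sum, Finset.sum_mul_sum]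
  refine Finset.sum_congr rfl fun α _ => Finset.sum_congr rfl fun β _ => ?_
  rw [Finset.prod_mul_distrib, map_mul, map_prod, Complex.conj_ofReal, Complex.ofReal_mul]
  simp only [map_pow]
  ring

theorem integrable_prod_pow_mul_conj_pow (hL : absMoment μ (2 * (L : ℤ)) ≠ 0) {α β : ι →₀ ℕ}
    (hα : ∀ i, α i ≤ L) (hβ : ∀ i, β i ≤ L) :
    Integrable (fun x : ι → ℂ => ∏ i, (x i ^ α i * conj (x i) ^ β i)) (Measure.pi fun _ => μ) :=
  Integrable.fintype_prod (f := fun i (z : ℂ) => z ^ α i * conj z ^ β i) fun i =>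
    integrable_pow_mul_conj_pow hL (by linarith [hα i, hβ i])

variable {P Q : MvPolynomial ι ℝ}

theorem integrable_aeval_mul_conj_aeval (hL : absMoment μ (2 * (L : ℤ)) ≠ 0)
    (hP : ∀ α ∈ P.support, ∀ i, α i ≤ L) (hQ : ∀ α ∈ Q.support, ∀ i, α i ≤ L) :
    Integrable (fun x : ι → ℂ => aeval x P * conj (aeval x Q)) (Measure.pi fun _ => μ) := by
  simp only [aeval_mul_conj_aeval_eq_sum]
  exact integrable_finsetSum _ fun α hα => integrable_finsetSum _ fun β hβ =>
    (integrable_prod_pow_mul_conj_pow hL (hP α hα) (hQ β hβ)).const_mul _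

theorem integral_aeval_mul_conj_aeval (hrot : IsRotationInvariant μ)
    (hL : absMoment μ (2 * (L : ℤ)) ≠ 0)
    (hP : ∀ α ∈ P.support, ∀ i, α i ≤ L) (hQ : ∀ α ∈ Q.support, ∀ i, α i ≤ L) :
    ∫ x : ι → ℂ, aeval x P * conj (aeval x Q) ∂(Measure.pi fun _ => μ) =
      (coeffPairing (fun α => ∏ i, absMoment μ (2 * (α i : ℤ))) P Q : ℂ) := by
  have hint : ∀ α ∈ P.support, ∀ β ∈ Q.support, Integrable (fun x : ι → ℂ =>
      ((coeff α P * coeff β Q : ℝ) : ℂ) * ∏ i, (x i ^ α i * conj (x i) ^ β i))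
        (Measure.pi fun _ => μ) := fun α hα β hβ =>
    (integrable_prod_pow_mul_conj_pow hL (hP α hα) (hQ β hβ)).const_mul _
  simp only [aeval_mul_conj_aeval_eq_sum]
  rw [integral_finsetSum _ fun α hα => integrable_finsetSum _ fun β hβ => hint α hα β hβ,
    coeffPairing, Complex.ofReal_sum]
  refine Finset.sum_congr rfl fun α hα => ?_
  have hone : ∀ β, ∫ x : ι → ℂ, ∏ i, (x i ^ α i * conj (x i) ^ β i) ∂(Measure.pi fun _ => μ) =
      if β = α then ((∏ i, absMoment μ (2 * (α i : ℤ)) : ℝ) : ℂ) else 0 := fun β => by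
    rw [integral_fintype_prod_eq_prod (f := fun i (z : ℂ) => z ^ α i * conj z ^ β i)]
    simp only [hrot.integral_pow_mul_conj_pow]
    split_ifs with h
    · subst h; simp
    · obtain ⟨i, hi⟩ := DFunLike.ne_iff.1 h
      exact Finset.prod_eq_zero (Finset.mem_univ i) (if_neg (Ne.symm hi))
  rw [integral_finsetSum _ fun β hβ => hint α hα β hβ]
  simp only [integral_const_mul, hone, mul_ite, mul_zero]
  rw [Finset.sum_ite_eq']
  split_ifs with h
  · push_cast; rfl
  · rw [notMem_support_iff.1 h]; simp

end Pairing

theorem aeval_vandermondeDet {n : ℕ} (x : Fin n → ℂ) :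
    aeval x (vandermondeDet n) = (Matrix.vandermonde x).det := by
  rw [vandermondeDet, AlgHom.map_det]
  congr 1
  ext i j
  simp [Matrix.vandermonde_apply]

theorem det_polyKernel (μ : Measure ℂ) {n : ℕ} (x : Fin n → ℂ) :
    Matrix.det (Matrix.of fun i j : Fin n => polyKernel μ n (x i) (x j)) =
      (((∏ l ∈ Finset.range n, absMoment μ (2 * (l : ℤ)))⁻¹ : ℝ) : ℂ) *
        (aeval x (vandermondeDet n) * conj (aeval x (vandermondeDet n))) := by
  -- The kernel matrix is `V D V*`, with `V` the square Vandermonde matrix and `D` the inverse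
  -- moments.
  have hmat : (Matrix.of fun i j : Fin n => polyKernel μ n (x i) (x j)) =
      Matrix.vandermonde x * Matrix.diagonal (fun l : Fin n =>
        (((absMoment μ (2 * (l : ℤ)))⁻¹ : ℝ) : ℂ)) * (Matrix.vandermonde x).conjTranspose := by
    ext i j
    rw [Matrix.mul_apply, Matrix.of_apply, polyKernel, Finset.sum_range]
    refine Finset.sum_congr rfl fun l _ => ?_
    rw [Matrix.mul_diagonal, Matrix.conjTranspose_apply, Matrix.vandermonde_apply,
      Matrix.vandermonde_apply, mul_pow]
    simp
    ring
  rw [hmat, Matrix.det_mul, Matrix.det_mul, Matrix.det_diagonal, Matrix.det_conjTranspose,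
    aeval_vandermondeDet, Finset.prod_range]
  push_cast
  rw [Finset.prod_inv_distrib]
  simp only [starRingEnd_apply]
  ring

end

/-! ### Recovering the symmetrized joint law from the top intensity. -/

noncomputable section

theorem measurableSet_setOf_injective (n : ℕ) :
    MeasurableSet {x : Fin n → ℂ | Function.Injective x} := by
  have : {x : Fin n → ℂ | Function.Injective x} = ⋂ i, ⋂ j, {x | x i = x j → i = j} := by
    ext x; simp [Function.Injective]
  rw [this]
  refine MeasurableSet.iInter fun i => MeasurableSet.iInter fun j => ?_
  by_cases hij : i = j
  · simp [hij]
  · simp only [hij, imp_false]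
    exact (measurableSet_eq_fun (measurable_pi_apply i) (measurable_pi_apply j)).compl

/-- The injective families are covered by countably many boxes with pairwise disjoint sides. -/
theorem setOf_injective_eq_iUnion (n : ℕ) : {x : Fin n → ℂ | Function.Injective x} =
    ⋃ B : {B : Fin n → TopologicalSpace.countableBasis ℂ //
        Pairwise (Function.onFun Disjoint fun i => (B i : Set ℂ))},
      Set.univ.pi fun i => (B.1 i : Set ℂ) := by
  ext x
  simp only [Set.mem_ofPred_eq, Set.mem_iUnion, Set.mem_univ_pi]
  constructor
  · intro hx
    obtain ⟨U, hU, hd⟩ := (Set.finite_range x).t2_separation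
    choose B hB hxB hBU using fun i =>
      (TopologicalSpace.isBasis_countableBasis ℂ).exists_subset_of_mem_open
        (hU (x i)).1 (hU (x i)).2
    refine ⟨⟨fun i => ⟨B i, hB i⟩, fun i j hij => ?_⟩, hxB⟩
    exact (hd (Set.mem_range_self i) (Set.mem_range_self j) (hx.ne hij)).mono (hBU i) (hBU j)
  · rintro ⟨B, hB⟩ i j hij
    by_contra hne
    exact Set.disjoint_left.1 (B.2 hne) (hB i) (hij ▸ hB j)

/-- Two finite measures of the same mass, which agree on boxes with pairwise disjoint sides, and one
of which does not charge the diagonals, are equal. -/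
theorem measure_eq_of_disjoint_boxes {n : ℕ} {ν η : Measure (Fin n → ℂ)} [IsFiniteMeasure ν]
    (hbox : ∀ B : Fin n → Set ℂ, (∀ l, MeasurableSet (B l)) →
      Pairwise (Function.onFun Disjoint B) → ν (Set.univ.pi B) = η (Set.univ.pi B))
    (huniv : ν Set.univ = η Set.univ) (hdiag : η {x | Function.Injective x}ᶜ = 0) : ν = η := by
  set D := {x : Fin n → ℂ | Function.Injective x} with hD
  have hDm : MeasurableSet D := measurableSet_setOf_injective n
  have hηf : IsFiniteMeasure η := ⟨huniv ▸ measure_lt_top ν _⟩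
  have hres : ν.restrict D = η.restrict D := by
    rw [hD, setOf_injective_eq_iUnion, Measure.restrict_iUnion_congr]
    rintro ⟨B, hB⟩
    have hBm : ∀ i, MeasurableSet (B i : Set ℂ) := fun i =>
      (TopologicalSpace.isOpen_of_mem_countableBasis (B i).2).measurableSet
    -- Intersecting any box with a disjoint-sided one keeps the sides disjoint, so the hypothesis
    -- covers a generating π-system.
    refine ext_of_generate_finite _ generateFrom_pi.symm isPiSystem_pi ?_ ?_
    · rintro _ ⟨C, hC, rfl⟩
      have hCm : ∀ i, MeasurableSet (C i) := fun i => hC i (Set.mem_univ i)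
      rw [Measure.restrict_apply (MeasurableSet.univ_pi hCm),
        Measure.restrict_apply (MeasurableSet.univ_pi hCm), ← Set.pi_inter_distrib]
      refine hbox _ (fun l => (hCm l).inter (hBm l)) fun i j hij => ?_
      exact (hB hij).mono Set.inter_subset_right Set.inter_subset_right
    · rw [Measure.restrict_apply_univ, Measure.restrict_apply_univ]
      exact hbox _ hBm hB
  have hνD : ν D = η D := by
    simpa using congr_arg (fun m => m Set.univ) hres
  -- Disjoint boxes cannot see coincident points; equality of total masses is what excludes them for
  -- `ν`.
  have hνc : ν Dᶜ = 0 := by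
    rw [measure_compl hDm (measure_ne_top _ _), hνD, huniv,
      ← measure_compl hDm (measure_ne_top _ _), hdiag]
  rw [← Measure.restrict_add_restrict_compl (μ := ν) hDm,
    ← Measure.restrict_add_restrict_compl (μ := η) hDm, hres, Measure.restrict_eq_zero.2 hνc,
    Measure.restrict_eq_zero.2 hdiag]

variable {Ω : Type*} [MeasurableSpace Ω] {n : ℕ}

/-- The sum over all relabelings of the laws of the relabeled points. -/
def symmetrizedLaw (P : Measure Ω) (z : Fin n → Ω → ℂ) : Measure (Fin n → ℂ) :=
  ∑ σ : Equiv.Perm (Fin n), P.map fun ω i => z (σ i) ω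

theorem pointCount_eq_sum {Ω : Type*} (z : Fin n → Ω → ℂ) (B : Set ℂ) (ω : Ω) :
    (pointCount z B ω : ℝ≥0∞) = ∑ i, (z i ⁻¹' B).indicator 1 ω := by
  classical
  rw [pointCount, Set.ncard_eq_toFinset_card']
  simp [Set.indicator_apply, Finset.sum_boole]

/-- The product of counts expands over all maps from boxes to points. A non-injective map would put
one point in two disjoint sets, so only permutations contribute. -/
theorem lintegral_prod_pointCount (P : Measure Ω) {z : Fin n → Ω → ℂ} (hz : ∀ i, Measurable (z i))
    {B : Fin n → Set ℂ} (hB : ∀ l, MeasurableSet (B l))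
    (hd : Pairwise (Function.onFun Disjoint B)) :
    ∫⁻ ω, ∏ l, (pointCount z (B l) ω : ℝ≥0∞) ∂P = symmetrizedLaw P z (Set.univ.pi B) := by
  classical
  have hprod : ∀ (f : Fin n → Fin n) ω, ∏ l, (z (f l) ⁻¹' B l).indicator (1 : Ω → ℝ≥0∞) ω =
      ((fun ω l => z (f l) ω) ⁻¹' Set.univ.pi B).indicator 1 ω := fun f ω => by
    simp only [Set.indicator_apply, Set.mem_preimage, Set.mem_univ_pi, Pi.one_apply]
    rw [Finset.prod_ite_zero]
    simp
  have hmeas : ∀ f : Fin n → Fin n, Measurable fun ω l => z (f l) ω := fun f =>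
    measurable_pi_lambda _ fun l => hz _
  have hpt : ∀ ω, ∏ l, (pointCount z (B l) ω : ℝ≥0∞) = ∑ σ : Equiv.Perm (Fin n),
      ((fun ω l => z (σ l) ω) ⁻¹' Set.univ.pi B).indicator 1 ω := fun ω => by
    simp only [pointCount_eq_sum]
    rw [Finset.prod_univ_sum, Fintype.piFinset_univ]
    simp only [hprod]
    symm
    refine Finset.sum_of_injOn (fun σ : Equiv.Perm (Fin n) => (σ : Fin n → Fin n))
      (fun σ _ τ _ h => Equiv.coe_fn_injective h) (fun _ _ => by simp) (fun f _ hf => ?_)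
      (fun _ _ => rfl)
    have hninj : ¬ Function.Injective f := fun hinj => hf
      ⟨Equiv.ofBijective f (Finite.injective_iff_bijective.1 hinj), by simp, rfl⟩
    obtain ⟨i, j, hij, hne⟩ : ∃ i j, f i = f j ∧ i ≠ j := by
      simpa [Function.Injective] using hninj
    refine Set.indicator_of_notMem (fun h => ?_) _
    have h' := Set.mem_univ_pi.1 (Set.mem_preimage.1 h)
    have hj := h' j
    rw [← hij] at hj
    exact Set.disjoint_left.1 (hd hne) (h' i) hj
  simp only [hpt]
  refine (lintegral_finsetSum _ fun (σ : Equiv.Perm (Fin n)) _ =>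
    measurable_one.indicator (hmeas σ (MeasurableSet.univ_pi hB))).trans ?_
  rw [symmetrizedLaw, Measure.finsetSum_apply]
  refine Finset.sum_congr rfl fun σ _ => ?_
  rw [lintegral_indicator_one (hmeas σ (MeasurableSet.univ_pi hB)),
    Measure.map_apply (hmeas σ) (MeasurableSet.univ_pi hB)]

section Symmetrized

variable (P : Measure Ω) {z : Fin n → Ω → ℂ}

theorem symmetrizedLaw_univ [IsProbabilityMeasure P] (hz : ∀ i, Measurable (z i)) :
    symmetrizedLaw P z Set.univ = n.factorial := by
  rw [symmetrizedLaw, Measure.finsetSum_apply, Finset.sum_congr rfl (g := fun _ => 1)]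
  · simp [Fintype.card_perm]
  · intro σ _
    rw [Measure.map_apply (measurable_pi_lambda _ fun l => hz _) MeasurableSet.univ]
    simp

theorem integrable_of_integrable_symmetrizedLaw (hz : ∀ i, Measurable (z i))
    {f : (Fin n → ℂ) → ℂ} (hf : Integrable f (symmetrizedLaw P z)) :
    Integrable (fun ω => f fun i => z i ω) P := by
  have h := (integrable_finsetSum_measure.1 hf) 1 (Finset.mem_univ _)
  exact h.comp_measurable (measurable_pi_lambda _ fun l => hz _)

theorem integral_symmetrizedLaw (hz : ∀ i, Measurable (z i))
    {f : (Fin n → ℂ) → ℂ} (hsymm : ∀ (σ : Equiv.Perm (Fin n)) x, f (fun i => x (σ i)) = f x)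
    (hf : Integrable f (symmetrizedLaw P z)) :
    ∫ x, f x ∂(symmetrizedLaw P z) = n.factorial * ∫ ω, f (fun i => z i ω) ∂P := by
  have h := integrable_finsetSum_measure.1 hf
  rw [symmetrizedLaw, integral_finsetSum_measure h, Finset.sum_congr rfl
    (g := fun _ => ∫ ω, f (fun i => z i ω) ∂P)]
  · simp [Fintype.card_perm]
  · intro σ _
    rw [integral_map (by exact (measurable_pi_lambda _ fun l => hz _).aemeasurable)
      (h σ (Finset.mem_univ _)).1]
    exact integral_congr_ae (Eventually.of_forall fun ω => hsymm σ fun i => z i ω)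

end Symmetrized
end

/-! ### Mixed moments of power sums as weighted coefficient pairings. -/

noncomputable section
open MvPolynomial

variable {Ω : Type*} [MeasurableSpace Ω] {n k : ℕ} {μ : Measure ℂ}

/-- The squared norm of a monomial with respect to the `n`-fold power of `μ`, divided by that of the
staircase monomial. -/
def relWeight (μ : Measure ℂ) (n : ℕ) (α : Fin n →₀ ℕ) : ℝ :=
  (∏ i, absMoment μ (2 * (α i : ℤ))) / ∏ l ∈ Finset.range n, absMoment μ (2 * (l : ℤ))

theorem relWeight_eq_of_coeff_ne_zero {a : Fin k →₀ ℕ} {α : Fin n →₀ ℕ}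
    (hα : coeff α (psumProd n a * vandermondeDet n) ≠ 0) :
    relWeight μ n α = (∏ l ∈ Finset.univ.image α, absMoment μ (2 * (l : ℤ))) /
      ∏ l ∈ Finset.range n, absMoment μ (2 * (l : ℤ)) := by
  rw [relWeight, Finset.prod_image fun _ _ _ _ h => injective_of_coeff_psumProd_mul_ne_zero hα h]

theorem mvpoly_exponent_le {L : ℕ} {a : Fin k →₀ ℕ} (h : n + psumDegree a ≤ L) :
    ∀ α ∈ (psumProd n a * vandermondeDet n).support, ∀ i, α i ≤ L := fun _ hα i =>
  ((lt_of_coeff_psumProd_mul_ne_zero (mem_support_iff.1 hα) i).le).trans h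

theorem coeffPairing_const_mul {ι : Type*} (w : (ι →₀ ℕ) → ℝ) (c : ℝ) (P Q : MvPolynomial ι ℝ) :
    coeffPairing (fun α => c * w α) P Q = c * coeffPairing w P Q := by
  rw [coeffPairing, coeffPairing, Finset.mul_sum]
  exact Finset.sum_congr rfl fun α _ => by ring

variable {L : ℕ} (hrot : IsRotationInvariant μ) (hL : absMoment μ (2 * (L : ℤ)) ≠ 0)

/-- The density of the symmetrized law of the points of the determinantal process. -/
def vandermondeDensity (μ : Measure ℂ) (n : ℕ) (x : Fin n → ℂ) : ℝ :=
  (∏ l ∈ Finset.range n, absMoment μ (2 * (l : ℤ)))⁻¹ * ‖aeval x (vandermondeDet n)‖ ^ 2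

theorem re_det_polyKernel (μ : Measure ℂ) (n : ℕ) (x : Fin n → ℂ) :
    (Matrix.det (Matrix.of fun i j : Fin n => polyKernel μ n (x i) (x j))).re =
      vandermondeDensity μ n x := by
  rw [det_polyKernel, Complex.mul_conj, Complex.normSq_eq_norm_sq, ← Complex.ofReal_mul,
    Complex.ofReal_re, vandermondeDensity]

theorem continuous_aeval_mvPolynomial {ι : Type*} [Fintype ι] (P : MvPolynomial ι ℝ) :
    Continuous fun x : ι → ℂ => aeval x P := by
  simp only [aeval_eq_sum_coeff]
  fun_prop

theorem measurable_vandermondeDensity : Measurable (vandermondeDensity μ n) :=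
  (continuous_const.mul ((continuous_aeval_mvPolynomial _).norm.pow 2)).measurable

theorem vandermondeDensity_nonneg (x : Fin n → ℂ) : 0 ≤ vandermondeDensity μ n x := by
  refine mul_nonneg (inv_nonneg.2 (Finset.prod_nonneg fun l _ => ?_)) (by positivity)
  exact integral_nonneg fun z => by positivity

theorem vandermondeDensity_smul_eq (P Q : MvPolynomial (Fin n) ℝ) (x : Fin n → ℂ) :
    vandermondeDensity μ n x • (aeval x P * conj (aeval x Q)) =
      (((∏ l ∈ Finset.range n, absMoment μ (2 * (l : ℤ)))⁻¹ : ℝ) : ℂ) *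
        (aeval x (P * vandermondeDet n) * conj (aeval x (Q * vandermondeDet n))) := by
  have h := Complex.mul_conj (aeval x (vandermondeDet n))
  rw [Complex.normSq_eq_norm_sq] at h
  rw [vandermondeDensity, Complex.real_smul, Complex.ofReal_mul, ← h]
  simp only [map_mul]
  ring

variable [IsFiniteMeasure μ]

include hL in
theorem integrable_density_smul (a b : Fin k →₀ ℕ) (ha : n + psumDegree a ≤ L)
    (hb : n + psumDegree b ≤ L) :
    Integrable (fun x => vandermondeDensity μ n x •
      (aeval x (psumProd n a) * conj (aeval x (psumProd n b)))) (Measure.pi fun _ => μ) := by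
  simp only [vandermondeDensity_smul_eq]
  exact (integrable_aeval_mul_conj_aeval hL (mvpoly_exponent_le ha)
    (mvpoly_exponent_le hb)).const_mul _

include hrot hL in
theorem integral_density_smul (a b : Fin k →₀ ℕ) (ha : n + psumDegree a ≤ L)
    (hb : n + psumDegree b ≤ L) :
    ∫ x, vandermondeDensity μ n x •
      (aeval x (psumProd n a) * conj (aeval x (psumProd n b))) ∂(Measure.pi fun _ => μ) =
    (coeffPairing (relWeight μ n) (psumProd n a * vandermondeDet n)
      (psumProd n b * vandermondeDet n) : ℂ) := by
  simp only [vandermondeDensity_smul_eq]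
  rw [integral_const_mul, integral_aeval_mul_conj_aeval hrot hL (mvpoly_exponent_le ha)
    (mvpoly_exponent_le hb), ← Complex.ofReal_mul, ← coeffPairing_const_mul]
  congr 2
  ext α
  rw [relWeight, div_eq_inv_mul]

include hL in
theorem prod_absMoment_pos (hn : n ≤ L) :
    0 < ∏ l ∈ Finset.range n, absMoment μ (2 * (l : ℤ)) :=
  Finset.prod_pos fun _ hl => absMoment_pos hL ((Finset.mem_range.1 hl).le.trans hn)

-- The exponents of the Vandermonde determinant always fill `{0, …, n - 1}`, so every weight is 1.
-- This gives the total mass of the density.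
include hL in
theorem coeffPairing_relWeight_vandermondeDet (hn : n ≤ L) :
    coeffPairing (relWeight μ n) (vandermondeDet n) (vandermondeDet n) = n.factorial := by
  rw [← coeffPairing_vandermondeDet, coeffPairing, coeffPairing]
  refine Finset.sum_congr rfl fun α hα => ?_
  have hα' : coeff α (psumProd n (0 : Fin 0 →₀ ℕ) * vandermondeDet n) ≠ 0 := by
    rw [psumProd_zero, one_mul]; exact mem_support_iff.1 hα
  rw [relWeight_eq_of_coeff_ne_zero hα']
  have himg : Finset.univ.image α = Finset.range n := by
    refine Finset.eq_of_subset_of_card_le (fun m hm => ?_) ?_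
    · obtain ⟨i, -, rfl⟩ := Finset.mem_image.1 hm
      simpa [psumDegree] using lt_of_coeff_psumProd_mul_ne_zero hα' i
    · rw [(sum_image_of_coeff_psumProd_mul_ne_zero hα').1, Finset.card_range]
  rw [himg, div_self (prod_absMoment_pos hL hn).ne']

/-- The symmetrized law of the points is absolutely continuous, its density being proportional to
the squared modulus of the Vandermonde determinant. -/
theorem symmetrizedLaw_eq_withDensity (hrot : IsRotationInvariant μ)
    (hL : absMoment μ (2 * (L : ℤ)) ≠ 0) (hn : n ≤ L) (P : Measure Ω) [IsProbabilityMeasure P]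
    {z : Fin n → Ω → ℂ} (hz : ∀ i, Measurable (z i))
    (hdet : IsDeterminantalProcess P z (polyKernel μ n) μ) :
    symmetrizedLaw P z =
      (Measure.pi fun _ => μ).withDensity fun x => ENNReal.ofReal (vandermondeDensity μ n x) := by
  have hfin : IsFiniteMeasure (symmetrizedLaw P z) :=
    ⟨by rw [symmetrizedLaw_univ P hz]; exact ENNReal.natCast_lt_top _⟩
  refine measure_eq_of_disjoint_boxes (fun B hB hd => ?_) ?_ ?_
  · rw [← lintegral_prod_pointCount P hz hB hd, hdet n B hB hd,
      withDensity_apply _ (MeasurableSet.univ_pi hB)]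
    simp only [re_det_polyKernel]
  -- Empty products of power sums turn the general integral formula into the total mass, `n!` on
  -- both sides.
  · have h1 := integrable_density_smul hL (0 : Fin 0 →₀ ℕ) 0 (n := n) (by simpa [psumDegree] using hn)
      (by simpa [psumDegree] using hn)
    have h2 := integral_density_smul hrot hL (0 : Fin 0 →₀ ℕ) 0 (n := n)
      (by simpa [psumDegree] using hn) (by simpa [psumDegree] using hn)
    simp only [psumProd_zero, map_one, mul_one, one_mul, Complex.real_smul] at h1 h2
    rw [coeffPairing_relWeight_vandermondeDet hL hn, integral_complex_ofReal] at h2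
    have h2' := Complex.ofReal_injective h2
    rw [symmetrizedLaw_univ P hz, withDensity_apply _ MeasurableSet.univ, Measure.restrict_univ,
      ← ofReal_integral_eq_lintegral_ofReal _
        (Eventually.of_forall fun x => vandermondeDensity_nonneg x), h2', ENNReal.ofReal_natCast]
    exact h1.re
  · rw [withDensity_apply _ (measurableSet_setOf_injective n).compl,
      setLIntegral_congr_fun (g := 0) (measurableSet_setOf_injective n).compl]
    · simp
    · intro x hx
      have : (Matrix.vandermonde x).det = 0 := by
        by_contra h
        exact hx (Matrix.det_vandermonde_ne_zero_iff.1 h)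
      simp [vandermondeDensity, aeval_vandermondeDet, this]

variable {P : Measure Ω} [IsProbabilityMeasure P] {z : Fin n → Ω → ℂ}

theorem aeval_psumProd (a : Fin k →₀ ℕ) (x : Fin n → ℂ) :
    aeval x (psumProd n a) = ∏ j : Fin k, powerSum ((j : ℕ) + 1) x ^ a j := by
  simp [psumProd, psum, powerSum]

theorem aeval_psumProd_mul_conj (a b : Fin k →₀ ℕ) (x : Fin n → ℂ) :
    aeval x (psumProd n a) * conj (aeval x (psumProd n b)) =
      ∏ j : Fin k, powerSum ((j : ℕ) + 1) x ^ a j * conj (powerSum ((j : ℕ) + 1) x) ^ b j := by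
  rw [aeval_psumProd, aeval_psumProd, Finset.prod_mul_distrib, map_prod]
  simp only [map_pow]

theorem powerSum_comp_perm (j : ℕ) (σ : Equiv.Perm (Fin n)) (x : Fin n → ℂ) :
    powerSum j (fun i => x (σ i)) = powerSum j x :=
  Equiv.sum_comp σ fun i => x i ^ j

theorem determinantal_integrable_and_integral (hrot : IsRotationInvariant μ)
    (hL : absMoment μ (2 * (L : ℤ)) ≠ 0) (hz : ∀ i, Measurable (z i))
    (hdet : IsDeterminantalProcess P z (polyKernel μ n) μ) (a b : Fin k →₀ ℕ)
    (ha : n + psumDegree a ≤ L) (hb : n + psumDegree b ≤ L) :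
    Integrable (fun ω => ∏ j : Fin k, powerSum ((j : ℕ) + 1) (fun i => z i ω) ^ a j *
        conj (powerSum ((j : ℕ) + 1) (fun i => z i ω)) ^ b j) P ∧
    ∫ ω, ∏ j : Fin k, powerSum ((j : ℕ) + 1) (fun i => z i ω) ^ a j *
        conj (powerSum ((j : ℕ) + 1) (fun i => z i ω)) ^ b j ∂P =
      ((coeffPairing (relWeight μ n) (psumProd n a * vandermondeDet n)
        (psumProd n b * vandermondeDet n) / n.factorial : ℝ) : ℂ) := by
  have hlaw := symmetrizedLaw_eq_withDensity hrot hL (by omega) P hz hdet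
  have hm : Measurable fun x => ENNReal.ofReal (vandermondeDensity μ n x) :=
    measurable_vandermondeDensity.ennreal_ofReal
  have hint : Integrable (fun x : Fin n → ℂ => ∏ j : Fin k, powerSum ((j : ℕ) + 1) x ^ a j *
      conj (powerSum ((j : ℕ) + 1) x) ^ b j) (symmetrizedLaw P z) := by
    rw [hlaw, integrable_withDensity_iff_integrable_smul' hm (by simp)]
    simp only [ENNReal.toReal_ofReal (vandermondeDensity_nonneg _), ← aeval_psumProd_mul_conj]
    exact integrable_density_smul hL a b ha hb
  refine ⟨integrable_of_integrable_symmetrizedLaw P hz hint, ?_⟩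
  -- Power sums are symmetric, so symmetrizing the law only multiplies the expectation by `n!`.
  have h := integral_symmetrizedLaw P hz (fun σ x => by simp only [powerSum_comp_perm]) hint
  rw [hlaw, integral_withDensity_eq_integral_toReal_smul hm (by simp)] at h
  simp only [ENNReal.toReal_ofReal (vandermondeDensity_nonneg _), ← aeval_psumProd_mul_conj] at h
  rw [integral_density_smul hrot hL a b ha hb] at h
  have hn : (n.factorial : ℂ) ≠ 0 := by exact_mod_cast n.factorial_ne_zero
  simp only [← aeval_psumProd_mul_conj]
  rw [Complex.ofReal_div, h, Complex.ofReal_natCast, mul_div_cancel_left₀ _ hn]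

end

/-! ### Moments of independent complex Gaussians. -/

noncomputable section

theorem stdComplexGaussian_isRotationInvariant : IsRotationInvariant stdComplexGaussian := by
  intro u hu
  have hu0 : u ≠ 0 := by rintro rfl; simp at hu
  have hmeas : Measurable fun z : ℂ => u * z := by fun_prop
  have hvol : MeasurePreserving (fun z : ℂ => u * z) volume volume := by
    have := (rotation ⟨u, mem_sphere_zero_iff_norm.2 hu⟩).measurePreserving
    exact this
  ext s hs
  rw [Measure.map_apply hmeas hs, stdComplexGaussian, withDensity_apply _ (hmeas hs),
    withDensity_apply _ hs, ← hvol.setLIntegral_comp_preimage hs (by fun_prop)]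
  simp [hu]

theorem absMoment_stdComplexGaussian (a : ℕ) :
    absMoment stdComplexGaussian (2 * (a : ℤ)) = a.factorial := by
  rw [absMoment, stdComplexGaussian, integral_withDensity_eq_integral_toReal_smul (by fun_prop)
    (by simp)]
  have h := Complex.integral_rpow_mul_exp_neg_rpow (p := 2) (q := 2 * a) (by norm_num)
    (by linarith [a.cast_nonneg (α := ℝ)])
  have hG : Real.Gamma ((2 * (a : ℝ) + 2) / 2) = a.factorial := by
    rw [← Real.Gamma_nat_eq_factorial]; congr 1; ring
  rw [hG] at h
  have hpi := Real.pi_ne_zero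
  calc ∫ z : ℂ, (ENNReal.ofReal (Real.pi⁻¹ * Real.exp (-‖z‖ ^ 2))).toReal • ‖z‖ ^ (2 * (a : ℤ))
      = ∫ z : ℂ, Real.pi⁻¹ * (‖z‖ ^ (2 * (a : ℝ)) * Real.exp (-‖z‖ ^ (2 : ℝ))) := by
        congr 1
        ext z
        have h1 : ‖z‖ ^ (2 * (a : ℤ)) = ‖z‖ ^ (2 * (a : ℝ)) := by
          rw [← Real.rpow_intCast]; push_cast; rfl
        rw [ENNReal.toReal_ofReal (by positivity), h1, Real.rpow_two, smul_eq_mul]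
        ring
    _ = a.factorial := by
        rw [integral_const_mul, h]
        field_simp

theorem integral_gaussian_pow_mul_conj_pow (a b : ℕ) :
    ∫ z, z ^ a * conj z ^ b ∂stdComplexGaussian = if a = b then (a.factorial : ℂ) else 0 := by
  rw [stdComplexGaussian_isRotationInvariant.integral_pow_mul_conj_pow,
    absMoment_stdComplexGaussian, Complex.ofReal_natCast]

theorem isProbabilityMeasure_stdComplexGaussian : IsProbabilityMeasure stdComplexGaussian := by
  have h := absMoment_stdComplexGaussian 0
  simp [absMoment, measureReal_def] at h
  exact ⟨(ENNReal.toReal_eq_one_iff _).1 h⟩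

section

variable {Ω : Type*} [MeasurableSpace Ω] {P : Measure Ω} [IsProbabilityMeasure P] {k : ℕ}
  {Z : Fin k → Ω → ℂ} (hlaw : ∀ j, HasLaw (Z j) stdComplexGaussian P) (hind : iIndepFun Z P)
  (s : Fin k → ℝ) (a b : Fin k → ℕ)

theorem gaussian_factor_eq (s : ℝ) (a b : ℕ) (z : ℂ) : ((s : ℂ) * z) ^ a * conj ((s : ℂ) * z) ^ b =
    (s : ℂ) ^ (a + b) * (z ^ a * conj z ^ b) := by
  rw [map_mul, Complex.conj_ofReal]
  ring

include hlaw hind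

theorem map_gaussian_eq_pi : P.map (fun ω j => Z j ω) = Measure.pi fun _ => stdComplexGaussian := by
  rw [(iIndepFun_iff_map_fun_eq_pi_map fun j => (hlaw j).aemeasurable).1 hind]
  simp only [(hlaw _).map_eq]

theorem integrable_gaussian_prod : Integrable (fun ω => ∏ j, ((s j : ℂ) * Z j ω) ^ a j *
    conj ((s j : ℂ) * Z j ω) ^ b j) P := by
  have := isProbabilityMeasure_stdComplexGaussian
  have hm : AEMeasurable (fun ω j => Z j ω) P :=
    aemeasurable_pi_lambda _ fun j => (hlaw j).aemeasurable
  have h : Integrable (fun x : Fin k → ℂ => ∏ j, ((s j : ℂ) * x j) ^ a j *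
      conj ((s j : ℂ) * x j) ^ b j) (P.map fun ω j => Z j ω) := by
    rw [map_gaussian_eq_pi hlaw hind]
    refine Integrable.fintype_prod (f := fun j (z : ℂ) => ((s j : ℂ) * z) ^ a j *
      conj ((s j : ℂ) * z) ^ b j) fun j => ?_
    simp only [gaussian_factor_eq]
    refine Integrable.const_mul (integrable_pow_mul_conj_pow (L := a j + b j) ?_ (by omega)) _
    rw [absMoment_stdComplexGaussian]
    positivity
  exact h.comp_aemeasurable hm

theorem integral_gaussian_prod : ∫ ω, ∏ j, ((s j : ℂ) * Z j ω) ^ a j *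
    conj ((s j : ℂ) * Z j ω) ^ b j ∂P =
      if a = b then ∏ j, ((s j : ℂ) ^ 2) ^ a j * (a j).factorial else 0 := by
  have := isProbabilityMeasure_stdComplexGaussian
  have hm : AEMeasurable (fun ω j => Z j ω) P :=
    aemeasurable_pi_lambda _ fun j => (hlaw j).aemeasurable
  have hc : Continuous fun x : Fin k → ℂ => ∏ j, ((s j : ℂ) * x j) ^ a j *
      conj ((s j : ℂ) * x j) ^ b j := by fun_prop
  rw [← integral_map hm hc.aestronglyMeasurable, map_gaussian_eq_pi hlaw hind,
    integral_fintype_prod_eq_prod (f := fun j (z : ℂ) => ((s j : ℂ) * z) ^ a j *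
      conj ((s j : ℂ) * z) ^ b j)]
  simp only [gaussian_factor_eq, integral_const_mul, integral_gaussian_pow_mul_conj_pow]
  split_ifs with hab
  · subst hab
    refine Finset.prod_congr rfl fun j _ => ?_
    rw [if_pos rfl]
    ring
  · obtain ⟨j, hj⟩ := Function.ne_iff.1 hab
    exact Finset.prod_eq_zero (Finset.mem_univ j) (by rw [if_neg hj, mul_zero])

end
end

/-! ### Asymptotics of the weights and the limit of the pairings. -/

noncomputable section
open MvPolynomial

/-- If `S` differs from `{0, …, n - 1}` only within distance `d` of `n`, and `M` varies little there,
then the products of `M` over both sets are close to each other. -/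
theorem abs_prod_div_prod_range_sub_one_le {M : ℕ → ℝ} {n d : ℕ} {ε : ℝ} (hε0 : 0 ≤ ε) (hε1 : ε < 1)
    (hd : d ≤ n) (hpos : ∀ l ≤ n + d, 0 < M l)
    (hM : ∀ l, n - d ≤ l → l < n + d → |M l / M n - 1| ≤ ε)
    {S : Finset ℕ} (hcard : S.card = n) (hlow : Finset.range (n - d) ⊆ S)
    (hup : ∀ l ∈ S, l < n + d) :
    |(∏ l ∈ S, M l) / (∏ l ∈ Finset.range n, M l) - 1| ≤ ((1 + ε) / (1 - ε)) ^ d - 1 := by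
  have hMn : 0 < M n := hpos n (by omega)
  have hbound : ∀ T : Finset ℕ, T.card = d → (∀ l ∈ T, n - d ≤ l ∧ l < n + d) →
      (1 - ε) ^ d ≤ ∏ l ∈ T, M l / M n ∧ ∏ l ∈ T, M l / M n ≤ (1 + ε) ^ d := by
    intro T hT hTl
    have h : ∀ l ∈ T, 1 - ε ≤ M l / M n ∧ M l / M n ≤ 1 + ε := fun l hl => by
      have := abs_le.1 (hM l (hTl l hl).1 (hTl l hl).2)
      constructor <;> linarith
    rw [← hT, ← Finset.prod_const, ← Finset.prod_const]
    refine ⟨Finset.prod_le_prod (fun _ _ => by linarith) fun l hl => (h l hl).1,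
      Finset.prod_le_prod (fun l hl => ?_) fun l hl => (h l hl).2⟩
    linarith [(h l hl).1]
  have hsub : Finset.range (n - d) ⊆ Finset.range n := Finset.range_mono (Nat.sub_le n d)
  have hT := hbound (S \ Finset.range (n - d))
    (by rw [Finset.card_sdiff_of_subset hlow, hcard, Finset.card_range]; omega)
    fun l hl => by
      rw [Finset.mem_sdiff, Finset.mem_range, not_lt] at hl
      exact ⟨hl.2, hup l hl.1⟩
  have hU := hbound (Finset.range n \ Finset.range (n - d))
    (by rw [Finset.card_sdiff_of_subset hsub, Finset.card_range, Finset.card_range]; omega)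
    fun l hl => by
      rw [Finset.mem_sdiff, Finset.mem_range, Finset.mem_range, not_lt] at hl
      omega
  -- Once the common factor over `range (n - d)` cancels, `d` factors remain on each side, so
  -- dividing each by `M n` does not change the quotient.
  have hratio : (∏ l ∈ S, M l) / (∏ l ∈ Finset.range n, M l) =
      (∏ l ∈ S \ Finset.range (n - d), M l / M n) /
        ∏ l ∈ Finset.range n \ Finset.range (n - d), M l / M n := by
    have h0 : ∏ l ∈ Finset.range (n - d), M l ≠ 0 := (Finset.prod_pos fun l hl =>
      hpos l (by rw [Finset.mem_range] at hl; omega)).ne'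
    rw [← Finset.prod_sdiff hlow, ← Finset.prod_sdiff hsub, mul_div_mul_right _ _ h0,
      Finset.prod_div_distrib, Finset.prod_div_distrib, Finset.prod_const, Finset.prod_const,
      Finset.card_sdiff_of_subset hlow, Finset.card_sdiff_of_subset hsub, hcard, Finset.card_range,
      Finset.card_range, div_div_div_cancel_right₀ (pow_pos hMn _).ne']
  have ha : 0 < (1 - ε) ^ d := pow_pos (by linarith) d
  have hb : 0 < (1 + ε) ^ d := pow_pos (by linarith) d
  have hUpos := ha.trans_le hU.1
  rw [hratio, div_pow, abs_le]
  set A := ∏ l ∈ S \ Finset.range (n - d), M l / M n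
  set B := ∏ l ∈ Finset.range n \ Finset.range (n - d), M l / M n
  have h1 : A / B ≤ (1 + ε) ^ d / (1 - ε) ^ d := div_le_div₀ hb.le hT.2 ha hU.1
  have h2 : (1 - ε) ^ d / (1 + ε) ^ d ≤ A / B := div_le_div₀ (ha.le.trans hT.1) hT.1 hUpos hU.2
  refine ⟨?_, by linarith⟩
  -- With `x` the upper bound for `A / B`, the inequality `x + 1/x ≥ 2` turns the lower bound `1/x`
  -- into `2 - x`, making the estimate symmetric about 1.
  have h3 : 2 ≤ (1 + ε) ^ d / (1 - ε) ^ d + (1 - ε) ^ d / (1 + ε) ^ d := by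
    rw [div_add_div _ _ ha.ne' hb.ne', le_div_iff₀ (by positivity)]
    nlinarith [sq_nonneg ((1 + ε) ^ d - (1 - ε) ^ d)]
  linarith

/-- Cauchy–Schwarz makes the error depend on the unweighted norms and not on the number of
monomials, which grows with `n`. -/
theorem abs_coeffPairing_sub_le {ι : Type*} {w : (ι →₀ ℕ) → ℝ} {δ : ℝ} (P Q : MvPolynomial ι ℝ)
    (hδ : 0 ≤ δ) (hw : ∀ α ∈ P.support, |w α - 1| ≤ δ) :
    |coeffPairing w P Q - coeffPairing (fun _ => 1) P Q| ≤
      δ * (√(coeffPairing (fun _ => 1) P P) * √(coeffPairing (fun _ => 1) Q Q)) := by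
  refine le_trans ?_ (mul_le_mul_of_nonneg_left (sum_abs_coeff_mul_le P Q) hδ)
  rw [coeffPairing, coeffPairing, ← Finset.sum_sub_distrib, Finset.mul_sum]
  refine (Finset.abs_sum_le_sum_abs _ _).trans (Finset.sum_le_sum fun α hα => ?_)
  rw [← mul_sub, abs_mul, mul_comm]
  exact mul_le_mul_of_nonneg_right (hw α hα) (abs_nonneg _)

theorem abs_relWeight_sub_one_le {μ : Measure ℂ} [IsFiniteMeasure μ] {n k : ℕ} {ε : ℝ}
    (hε0 : 0 ≤ ε) (hε1 : ε < 1) {a : Fin k →₀ ℕ} (ha : psumDegree a ≤ n)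
    (hL : absMoment μ (2 * ((n + psumDegree a : ℕ) : ℤ)) ≠ 0)
    (hM : ∀ l : ℕ, n - psumDegree a ≤ l → l < n + psumDegree a →
      |absMoment μ (2 * (l : ℤ)) / absMoment μ (2 * (n : ℤ)) - 1| ≤ ε)
    {α : Fin n →₀ ℕ} (hα : α ∈ (psumProd n a * vandermondeDet n).support) :
    |relWeight μ n α - 1| ≤ ((1 + ε) / (1 - ε)) ^ psumDegree a - 1 := by
  rw [mem_support_iff] at hα
  rw [relWeight_eq_of_coeff_ne_zero hα]
  refine abs_prod_div_prod_range_sub_one_le (M := fun l => absMoment μ (2 * (l : ℤ))) hε0 hε1 ha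
    (fun l hl => absMoment_pos hL hl) hM (sum_image_of_coeff_psumProd_mul_ne_zero hα).1 ?_ ?_
  · intro m hm
    rw [Finset.mem_range] at hm
    simpa using exists_eq_of_coeff_psumProd_mul_ne_zero hα (m := m) (by omega)
  · intro l hl
    obtain ⟨i, -, rfl⟩ := Finset.mem_image.1 hl
    exact lt_of_coeff_psumProd_mul_ne_zero hα i

/-- The limiting covariance of products of power sums. -/
def psumNormSq {k : ℕ} (a : Fin k →₀ ℕ) : ℝ := ∏ j : Fin k, ((j : ℕ) + 1 : ℝ) ^ a j * (a j).factorial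

/-- Both unweighted squared norms equal `n!` times a constant, so division by `n!` leaves a bound
free of `n`. -/
theorem abs_coeffPairing_relWeight_sub_le {μ : Measure ℂ} [IsFiniteMeasure μ] {n k : ℕ} {ε : ℝ}
    (hε0 : 0 ≤ ε) (hε1 : ε < 1) {a b : Fin k →₀ ℕ} (ha : psumDegree a ≤ n) (hb : psumDegree b ≤ n)
    (hL : absMoment μ (2 * ((n + psumDegree a : ℕ) : ℤ)) ≠ 0)
    (hM : ∀ l : ℕ, n - psumDegree a ≤ l → l < n + psumDegree a →
      |absMoment μ (2 * (l : ℤ)) / absMoment μ (2 * (n : ℤ)) - 1| ≤ ε) :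
    |coeffPairing (relWeight μ n) (psumProd n a * vandermondeDet n)
        (psumProd n b * vandermondeDet n) / n.factorial - if a = b then psumNormSq a else 0| ≤
      (((1 + ε) / (1 - ε)) ^ psumDegree a - 1) * (√(psumNormSq a) * √(psumNormSq b)) := by
  have hn : (0 : ℝ) < n.factorial := by positivity
  have hδ : 0 ≤ ((1 + ε) / (1 - ε)) ^ psumDegree a - 1 := sub_nonneg.2
    (one_le_pow₀ ((one_le_div (by linarith)).2 (by linarith)))
  have h := abs_coeffPairing_sub_le (psumProd n a * vandermondeDet n)
    (psumProd n b * vandermondeDet n) hδ fun α hα =>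
      abs_relWeight_sub_one_le hε0 hε1 ha hL hM hα
  rw [coeffPairing_psumProd a b ha hb, coeffPairing_psumProd a a ha ha,
    coeffPairing_psumProd b b hb hb, if_pos rfl, if_pos rfl, Real.sqrt_mul hn.le,
    Real.sqrt_mul hn.le, mul_mul_mul_comm, Real.mul_self_sqrt hn.le] at h
  rw [← mul_le_mul_iff_right₀ hn]
  calc _ = |coeffPairing (relWeight μ n) (psumProd n a * vandermondeDet n)
        (psumProd n b * vandermondeDet n) - n.factorial * if a = b then psumNormSq a else 0| := by
        rw [← abs_of_pos hn, ← abs_mul, abs_of_pos hn, mul_sub, mul_div_cancel₀ _ hn.ne']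
    _ ≤ _ := h
    _ = _ := by simp only [psumNormSq]; ring

section Limit

variable {μ : ℕ → Measure ℂ} (hmom : ∀ m : ℤ, Tendsto
  (fun n : ℕ => absMoment (μ n) (2 * (n : ℤ) + 2 * m) / absMoment (μ n) (2 * (n : ℤ))) atTop (𝓝 1))

include hmom

theorem eventually_absMoment_ne_zero (d : ℕ) :
    ∀ᶠ n : ℕ in atTop, absMoment (μ n) (2 * ((n + d : ℕ) : ℤ)) ≠ 0 := by
  filter_upwards [(hmom d).eventually_ne one_ne_zero] with n hn h
  rw [show 2 * ((n + d : ℕ) : ℤ) = 2 * (n : ℤ) + 2 * (d : ℤ) by push_cast; ring] at h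
  rw [h, zero_div] at hn
  exact hn rfl

theorem eventually_abs_absMoment_div_sub_one_le (d : ℕ) {ε : ℝ} (hε : 0 < ε) :
    ∀ᶠ n : ℕ in atTop, ∀ l : ℕ, n - d ≤ l → l < n + d →
      |absMoment (μ n) (2 * (l : ℤ)) / absMoment (μ n) (2 * (n : ℤ)) - 1| ≤ ε := by
  have h : ∀ᶠ n : ℕ in atTop, ∀ m ∈ Finset.Ico (-(d : ℤ)) d,
      |absMoment (μ n) (2 * (n : ℤ) + 2 * m) / absMoment (μ n) (2 * (n : ℤ)) - 1| ≤ ε := by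
    rw [Filter.eventually_all_finset]
    intro m _
    filter_upwards [Metric.tendsto_nhds.1 (hmom m) ε hε] with n hn
    exact hn.le
  filter_upwards [h] with n hn l h1 h2
  have := hn ((l : ℤ) - n) (by rw [Finset.mem_Ico]; omega)
  rwa [show 2 * (n : ℤ) + 2 * ((l : ℤ) - n) = 2 * (l : ℤ) by ring] at this

theorem tendsto_coeffPairing_relWeight [∀ n, IsFiniteMeasure (μ n)] {k : ℕ} (a b : Fin k →₀ ℕ) :
    Tendsto (fun n : ℕ => coeffPairing (relWeight (μ n) n) (psumProd n a * vandermondeDet n)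
      (psumProd n b * vandermondeDet n) / n.factorial) atTop
      (𝓝 (if a = b then psumNormSq a else 0)) := by
  have hg : Tendsto (fun ε : ℝ => (((1 + ε) / (1 - ε)) ^ psumDegree a - 1) *
      (√(psumNormSq a) * √(psumNormSq b))) (𝓝[>] 0) (𝓝 0) := by
    have : ContinuousAt (fun ε : ℝ => (((1 + ε) / (1 - ε)) ^ psumDegree a - 1) *
        (√(psumNormSq a) * √(psumNormSq b))) 0 := by
      fun_prop (disch := norm_num)
    have h := this.tendsto.mono_left (nhdsWithin_le_nhds (s := Set.Ioi 0))
    simpa using h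
  rw [Metric.tendsto_nhds]
  intro δ hδ
  obtain ⟨ε, hεδ, hε0, hε1⟩ := ((hg.eventually_lt_const hδ).and
    (Ioo_mem_nhdsGT (zero_lt_one' ℝ))).exists
  filter_upwards [eventually_ge_atTop (psumDegree a), eventually_ge_atTop (psumDegree b),
    eventually_absMoment_ne_zero hmom (psumDegree a),
    eventually_abs_absMoment_div_sub_one_le hmom (psumDegree a) hε0] with n ha hb hL hM
  rw [Real.dist_eq]
  exact (abs_coeffPairing_relWeight_sub_le hε0.le hε1 ha hb hL hM).trans_lt hεδ

end Limit
end

/-! ### Conclusion: matching the limit with the Gaussian moments. -/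

open MvPolynomial
theorem mainTheorem6
    -- the reference measures `μ_n`
    (μ : ℕ → Measure ℂ) [∀ n, IsFiniteMeasure (μ n)]
    (hrot : ∀ n, IsRotationInvariant (μ n))
    -- the moment condition with `ρ = 1`
    (hmom : ∀ m : ℤ, Tendsto
      (fun n : ℕ => absMoment (μ n) (2 * (n : ℤ) + 2 * m) / absMoment (μ n) (2 * (n : ℤ)))
      atTop (𝓝 1))
    -- for each `n`, points `z_1, …, z_n` drawn from the determinantal process `(K_n, μ_n)`
    {Ω : ℕ → Type*} [∀ n, MeasurableSpace (Ω n)] (P : ∀ n, Measure (Ω n))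
    [∀ n, IsProbabilityMeasure (P n)]
    (z : ∀ n, Fin n → Ω n → ℂ) (hz : ∀ n i, Measurable (z n i))
    (hdet : ∀ n, 1 ≤ n → IsDeterminantalProcess (P n) (z n) (polyKernel (μ n) n) (μ n))
    -- exponents; the index `j : Fin k` stands for the number `j + 1`
    (k : ℕ) (a b : Fin k → ℕ)
    -- independent standard complex Gaussians
    {Ω' : Type*} [MeasurableSpace Ω'] (P' : Measure Ω') [IsProbabilityMeasure P']
    (Z : Fin k → Ω' → ℂ) (hZlaw : ∀ j, HasLaw (Z j) stdComplexGaussian P')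
    (hZindep : iIndepFun Z P') :
    (∀ᶠ n in atTop, Integrable (fun ω : Ω n =>
      ∏ j : Fin k, powerSum ((j : ℕ) + 1) (fun i => z n i ω) ^ a j *
        conj (powerSum ((j : ℕ) + 1) (fun i => z n i ω)) ^ b j) (P n)) ∧
    Integrable (fun ω : Ω' =>
      ∏ j : Fin k, (((√(((j : ℕ) + 1 : ℕ) : ℝ) : ℝ) : ℂ) * Z j ω) ^ a j *
        conj ((((√(((j : ℕ) + 1 : ℕ) : ℝ) : ℝ) : ℂ) * Z j ω) ^ b j)) P' ∧
    Tendsto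
      (fun n : ℕ => ∫ ω : Ω n,
        ∏ j : Fin k, powerSum ((j : ℕ) + 1) (fun i => z n i ω) ^ a j *
          conj (powerSum ((j : ℕ) + 1) (fun i => z n i ω)) ^ b j ∂(P n))
      atTop
      (𝓝 (∫ ω : Ω',
        ∏ j : Fin k, (((√(((j : ℕ) + 1 : ℕ) : ℝ) : ℝ) : ℂ) * Z j ω) ^ a j *
          conj ((((√(((j : ℕ) + 1 : ℕ) : ℝ) : ℝ) : ℂ) * Z j ω) ^ b j) ∂P')) := by
  set a' : Fin k →₀ ℕ := Finsupp.equivFunOnFinite.symm a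
  set b' : Fin k →₀ ℕ := Finsupp.equivFunOnFinite.symm b
  have hev : ∀ᶠ n in atTop, Integrable (fun ω : Ω n =>
        ∏ j : Fin k, powerSum ((j : ℕ) + 1) (fun i => z n i ω) ^ a j *
          conj (powerSum ((j : ℕ) + 1) (fun i => z n i ω)) ^ b j) (P n) ∧
      ∫ ω, ∏ j : Fin k, powerSum ((j : ℕ) + 1) (fun i => z n i ω) ^ a j *
          conj (powerSum ((j : ℕ) + 1) (fun i => z n i ω)) ^ b j ∂(P n) =
        ((coeffPairing (relWeight (μ n) n) (psumProd n a' * vandermondeDet n)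
          (psumProd n b' * vandermondeDet n) / n.factorial : ℝ) : ℂ) := by
    filter_upwards [eventually_ge_atTop 1,
      -- One nonzero moment, of order `2 * (n + deg a + deg b)`, dominates all exponents of both
      -- polynomials.
      eventually_absMoment_ne_zero hmom (psumDegree a' + psumDegree b')] with n hn hL
    exact determinantal_integrable_and_integral (hrot n) hL (hz n) (hdet n hn) a' b'
      (by omega) (by omega)
  refine ⟨hev.mono fun n h => h.1, by
    simpa only [map_pow] using integrable_gaussian_prod hZlaw hZindep
      (fun j => √(((j : ℕ) + 1 : ℕ) : ℝ)) a b, ?_⟩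
  have hlim := (Complex.continuous_ofReal.tendsto _).comp
    (tendsto_coeffPairing_relWeight hmom a' b')
  have hgauss : (((if a' = b' then psumNormSq a' else 0 : ℝ)) : ℂ) = ∫ ω : Ω',
      ∏ j : Fin k, (((√(((j : ℕ) + 1 : ℕ) : ℝ) : ℝ) : ℂ) * Z j ω) ^ a j *
        conj ((((√(((j : ℕ) + 1 : ℕ) : ℝ) : ℝ) : ℂ) * Z j ω) ^ b j) ∂P' := by
    simp only [map_pow]
    rw [integral_gaussian_prod hZlaw hZindep (fun j => √(((j : ℕ) + 1 : ℕ) : ℝ)) a b]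
    have hab : a' = b' ↔ a = b := Finsupp.equivFunOnFinite.symm.injective.eq_iff
    by_cases h : a = b
    · rw [if_pos h, if_pos (hab.2 h), psumNormSq, Complex.ofReal_prod]
      refine Finset.prod_congr rfl fun j _ => ?_
      rw [← Complex.ofReal_pow, Real.sq_sqrt (Nat.cast_nonneg _)]
      push_cast
      rfl
    · rw [if_neg h, if_neg (mt hab.1 h), Complex.ofReal_zero]
  rw [← hgauss]
  exact hlim.congr' (hev.mono fun n h => h.2.symm)
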